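/- Let $\mathbb F$ be a field, $k\ge 2$, and let $P(\lambda)=\sum_{i=0}^k A_i\lambda^i$ with $A_i\in\mathbb F^{n\times n}$ be a matrix polynomial of grade $k$ ($A_k$ may be zero). Elementary matrices. For $B\in\mathbb F^{n\times n}$ put $M_0(B)=\operatorname{diag}(I_{(k-1)n},B)$, $M_{-k}(B)=\operatorname{diag}(B,I_{(k-1)n})$ and, for $1\le i\le k-1$, $$M_i(B)=I_{(k-i-1)n}\oplus\begin{bmatrix}B&I_n\\ I_n&0\end{bmatrix}\oplus I_{(i-1)n},\qquad M_{-i}(B)=I_{(k-i-1)n}\oplus\begin{bmatrix}0&I_n\\ I_n&B\end{bmatrix}\oplus I_{(i-1)n}.$$ Put $M_i^P=M_i(-A_i)$ for $0\le i\le k-1$, $M_{-i}^P=M_{-i}(A_i)$ for $1\le i\le k$, $M_{-0}^P=(M_0^P)^{-1}$ and $M_k^P=(M_{-k}^P)^{-1}$ (the symbols $0$ and $-0$ are distinct indices). For an index tuple $\mathbf t=(t_1,\dots,t_r)$ put $M_{\mathbf t}^P=M_{t_1}^P\cdots M_{t_r}^P$ (the identity if $r=0$). Generalized Fiedler pencils.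 Let $\{C_0,C_1\}$ be a partition of $\{0,\dots,k\}$ (one of the sets may be empty), and let $\mathbf q$ and $\mathbf z$ be permutations of $C_0$ and of $-C_1$. Suppose that $A_0$ is nonsingular if $0\in C_1$ and that $A_k$ is nonsingular if $k\in C_0$, so that $K_{\mathbf q,\mathbf z}(\lambda)=\lambda M_{\mathbf z}^P-M_{\mathbf q}^P$ is defined. Suppose that this generalized Fiedler pencil is non-proper, i.e. $0\in C_1$ or $k\in C_0$. Let $L=\operatorname{diag}(L_1,I_n,\dots,I_n,L_2)$ and $R=\operatorname{diag}(R_1,I_n,\dots,I_n,R_2)$ be the $kn\times kn$ block-diagonal matrices with * $R_2=-A_0$ if $-0,-1\in\mathbf z$ and $-0$ is to the right of $-1$ in $\mathbf z$, or if $-0\in\mathbf z$ and $-1\notin\mathbf z$; $R_2=I_n$ otherwise; * $L_2=-A_0$ if $-0,-1\in\mathbf z$ and $-0$ is to the left of $-1$ in $\mathbf z$; $L_2=I_n$ otherwise; * $R_1=A_k$ if $k,k-1\in\mathbf q$ and $k$ is to the right of $k-1$ in $\mathbf q$, or if $k\in\mathbf q$ and $k-1\notin\mathbf q$; $R_1=I_n$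 otherwise; * $L_1=A_k$ if $k,k-1\in\mathbf q$ and $k$ is to the left of $k-1$ in $\mathbf q$; $L_1=I_n$ otherwise. For a permutation $\mathbf c$ of $\{1,\dots,k\}$ let $\Pi_{\mathbf c}^n$ be the $k\times k$ block-matrix whose $(c_i,i)$ blocks are $I_n$, all other blocks being $0_n$, and let $H^{\mathcal B}$ denote the block-transpose of a block-matrix $H$ (the $(i,j)$ block of $H^{\mathcal B}$ is the $(j,i)$ block of $H$). Let $L_s(\lambda)$ (not to be confused with $L_1,L_2$) be the $s\times(s+1)$ pencil with entries $-1$ in the positions $(i,i)$, $\lambda$ in the positions $(i,i+1)$, and $0$ elsewhere. Then there exist permutations $\boldsymbol\ell,\mathbf r$ of $\{1,\dots,k\}$, integers $p,q\ge 0$ with $p+q+1=k$, and a $(q+1)n\times(p+1)n$ pencil $M(\lambda)=\lambda M_1+M_0$ such that $$(\Pi_{\boldsymbol\ell}^n)^{\mathcal B}\,L\,K_{\mathbf q,\mathbf z}(\lambda)\,R\,\Pi_{\mathbf r}^n=\left[\begin{array}{c|c}M(\lambda)&L_q(\lambda)^T\otimes I_n\\ \hline L_p(\lambda)\otimes I_n&0\end{array}\right]$$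 (a block Kronecker pencil with body $M(\lambda)$; if $p=0$ or $q=0$ the corresponding blocks are absent), and $M(\lambda)$ satisfies the AS (antidiagonal sum) condition for $P(\lambda)$: with $[M_1]_{ij}$, $[M_0]_{ij}$ denoting the $n\times n$ blocks of $M_1$, $M_0$ $(1\le i\le q+1$, $1\le j\le p+1)$, $$\sum_{i+j=k+2-s}[M_1]_{ij}+\sum_{i+j=k+1-s}[M_0]_{ij}=A_s,\qquad s=0,1,\dots,k.$$ -/

import Mathlib

open Matrix Polynomial
open scoped Kronecker

/-! Block matrices: a `k × l` block-matrix with blocks of size `n × n` is a matrix with rows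
indexed by `Fin k × Fin n` and columns by `Fin l × Fin n`; the first component is the block index.
Block indices are `0`-based in the code.  Matrix polynomials are matrices over `F[X]`. -/

namespace Fiedler

noncomputable section

variable {F : Type*} [Field F]

/-! ### Matrix polynomials -/

/-- `P` has grade `k`: it can be written `∑_{i ≤ k} A_i λ^i`. -/
def HasGrade {r c : Type*} (k : ℕ) (P : Matrix r c F[X]) : Prop :=
  ∀ i j, (P i j).natDegree ≤ k

/-- The matrix coefficient `A_i` of `λ^i` in `P`. -/
def coeffMat {r c : Type*} (P : Matrix r c F[X]) (i : ℕ) : Matrix r c F :=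
  P.map fun f => f.coeff i

/-- A constant matrix, seen as a matrix polynomial. -/
def constMat {r c : Type*} (A : Matrix r c F) : Matrix r c F[X] :=
  A.map fun a => Polynomial.C a

/-! ### Block matrices -/

/-- The `(i, j)` block of a block-matrix. -/
def blk {R : Type*} {k l n : ℕ} (H : Matrix (Fin k × Fin n) (Fin l × Fin n) R)
    (i : Fin k) (j : Fin l) : Matrix (Fin n) (Fin n) R :=
  fun a b => H (i, a) (j, b)

/-- The block-matrix with given blocks. -/
def ofBlocks {R : Type*} {k l n : ℕ} (B : Fin k → Fin l → Matrix (Fin n) (Fin n) R) :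
    Matrix (Fin k × Fin n) (Fin l × Fin n) R :=
  fun x y => B x.1 y.1 x.2 y.2

/-- The block-transpose: blocks are moved to the transposed positions but are not themselves
transposed. -/
def blockTranspose {R : Type*} {k l n : ℕ} (H : Matrix (Fin k × Fin n) (Fin l × Fin n) R) :
    Matrix (Fin l × Fin n) (Fin k × Fin n) R :=
  ofBlocks fun i j => blk H j i

/-- The block-permutation matrix of `c`: its `(c i, i)` blocks are `I_n`, the others are `0`. -/
def blockPerm {R : Type*} [Zero R] [One R] {k : ℕ} (n : ℕ) (c : Equiv.Perm (Fin k)) :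
    Matrix (Fin k × Fin n) (Fin k × Fin n) R :=
  ofBlocks fun i j => if i = c j then 1 else 0

/-- The block-diagonal matrix `diag(D₁, I_n, …, I_n, D₂)` with `k` diagonal blocks (`k ≥ 2`). -/
def cornerDiag {n : ℕ} (k : ℕ) (D₁ D₂ : Matrix (Fin n) (Fin n) F) :
    Matrix (Fin k × Fin n) (Fin k × Fin n) F :=
  ofBlocks fun r s =>
    if r = s then
      if (r : ℕ) = 0 then D₁ else if (r : ℕ) + 1 = k then D₂ else 1
    else 0

/-! ### Elementary matrices -/

/-- The elementary matrix `M_i(B)` for `0 ≤ i ≤ k - 1`.  With `0`-based block indices, for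
`1 ≤ i ≤ k - 1` the block-rows and block-columns `k - i - 1, k - i` carry `[B, I; I, 0]` and the
rest is the identity; for `i = 0` there is no block index `k - i`, and the matrix is
`diag(I, …, I, B)`. -/
def elemPosCore {n : ℕ} (k i : ℕ) (B : Matrix (Fin n) (Fin n) F) :
    Matrix (Fin k × Fin n) (Fin k × Fin n) F :=
  ofBlocks fun r s =>
    if (r : ℕ) + i + 1 = k ∧ (s : ℕ) + i + 1 = k then B
    else if (r : ℕ) + i + 1 = k ∧ (s : ℕ) + i = k then 1
    else if (r : ℕ) + i = k ∧ (s : ℕ) + i + 1 = k then 1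
    else if (r : ℕ) + i = k ∧ (s : ℕ) + i = k then 0
    else if r = s then 1 else 0

/-- The elementary matrix `M_{-i}(B)` for `1 ≤ i ≤ k`.  With `0`-based block indices, for
`1 ≤ i ≤ k - 1` the block-rows and block-columns `k - i - 1, k - i` carry `[0, I; I, B]` and the
rest is the identity; for `i = k` there is no block index `k - i - 1`, and the matrix is
`diag(B, I, …, I)`. -/
def elemNegCore {n : ℕ} (k i : ℕ) (B : Matrix (Fin n) (Fin n) F) :
    Matrix (Fin k × Fin n) (Fin k × Fin n) F :=
  ofBlocks fun r s =>
    if (r : ℕ) + i + 1 = k ∧ (s : ℕ) + i + 1 = k then 0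
    else if (r : ℕ) + i + 1 = k ∧ (s : ℕ) + i = k then 1
    else if (r : ℕ) + i = k ∧ (s : ℕ) + i + 1 = k then 1
    else if (r : ℕ) + i = k ∧ (s : ℕ) + i = k then B
    else if r = s then 1 else 0

/-- The elementary matrix `M_i(B)` for `0 ≤ i ≤ k`, where `M_k(B) = M_{-k}(B)⁻¹`. -/
def elemPos {n : ℕ} (k i : ℕ) (B : Matrix (Fin n) (Fin n) F) :
    Matrix (Fin k × Fin n) (Fin k × Fin n) F :=
  if i = k then (elemNegCore k k B)⁻¹ else elemPosCore k i B

/-- The elementary matrix `M_{-i}(B)` for `0 ≤ i ≤ k`, where `M_{-0}(B) = M_0(B)⁻¹`. -/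
def elemNeg {n : ℕ} (k i : ℕ) (B : Matrix (Fin n) (Fin n) F) :
    Matrix (Fin k × Fin n) (Fin k × Fin n) F :=
  if i = 0 then (elemPosCore k 0 B)⁻¹ else elemNegCore k i B

/-- `M_i^P`: it is `M_i(-A_i)` for `i < k`, and `M_k^P = (M_{-k}^P)⁻¹ = M_k(A_k)`. -/
def elemPosP {n : ℕ} (k : ℕ) (P : Matrix (Fin n) (Fin n) F[X]) (i : ℕ) :
    Matrix (Fin k × Fin n) (Fin k × Fin n) F :=
  if i = k then elemPos k k (coeffMat P k) else elemPos k i (-coeffMat P i)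

/-- `M_{-i}^P`: it is `M_{-i}(A_i)` for `1 ≤ i ≤ k`, and `M_{-0}^P = (M_0^P)⁻¹ = M_{-0}(-A_0)`. -/
def elemNegP {n : ℕ} (k : ℕ) (P : Matrix (Fin n) (Fin n) F[X]) (i : ℕ) :
    Matrix (Fin k × Fin n) (Fin k × Fin n) F :=
  if i = 0 then elemNeg k 0 (-coeffMat P 0) else elemNeg k i (coeffMat P i)

/-! ### Generalized Fiedler pencils

The tuple `q` of indices from `C₀ ⊆ {0, …, k}` is a list of naturals.  The tuple `z` of indices
from `-C₁` is given by the list of the absolute values of its entries: an entry `j` of the list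
stands for the index `-j`.  In this way `0` (in `q`) and `-0` (in `z`) are kept apart. -/

/-- `q` is a permutation of `C₀` and `z` one of `-C₁` for a partition `{C₀, C₁}` of `{0, …, k}`
(one of the two sets may be empty). -/
def IsGFPTuples (k : ℕ) (q z : List ℕ) : Prop :=
  q.Nodup ∧ z.Nodup ∧ Disjoint q.toFinset z.toFinset ∧
    q.toFinset ∪ z.toFinset = Finset.range (k + 1)

/-- The pencil is proper if `0 ∈ C₀` and `k ∈ C₁`. -/
def IsProper (k : ℕ) (q z : List ℕ) : Prop := 0 ∈ q ∧ k ∈ z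

/-- `M_q^P`, the product of the matrices `M_i^P` in the order of the tuple `q`. -/
def prodPos {n : ℕ} (k : ℕ) (P : Matrix (Fin n) (Fin n) F[X]) (q : List ℕ) :
    Matrix (Fin k × Fin n) (Fin k × Fin n) F :=
  (q.map (elemPosP k P)).prod

/-- `M_z^P`, the product of the matrices `M_{-j}^P` in the order of the tuple `z`. -/
def prodNeg {n : ℕ} (k : ℕ) (P : Matrix (Fin n) (Fin n) F[X]) (z : List ℕ) :
    Matrix (Fin k × Fin n) (Fin k × Fin n) F :=
  (z.map (elemNegP k P)).prod

/-- The generalized Fiedler pencil `K_{q,z}(λ) = λ M_z^P - M_q^P`. -/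
def gfp {n : ℕ} (k : ℕ) (P : Matrix (Fin n) (Fin n) F[X]) (q z : List ℕ) :
    Matrix (Fin k × Fin n) (Fin k × Fin n) F[X] :=
  (X : F[X]) • constMat (prodNeg k P z) - constMat (prodPos k P q)

/-! ### The block-diagonal factors `L` and `R` -/

/-- The entry `a` is to the left of the entry `b` in the tuple `t` (which contains both). -/
def LeftOf (a b : ℕ) (t : List ℕ) : Prop :=
  a ∈ t ∧ b ∈ t ∧ t.idxOf a < t.idxOf b

open Classical in
/-- The last diagonal block of `R`: `-A_0` if `-0, -1 ∈ z` with `-0` to the right of `-1`, or if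
`-0 ∈ z` and `-1 ∉ z`; otherwise `I_n`. -/
def R₂ {n : ℕ} (P : Matrix (Fin n) (Fin n) F[X]) (z : List ℕ) : Matrix (Fin n) (Fin n) F :=
  if LeftOf 1 0 z then -coeffMat P 0
  else if 0 ∈ z ∧ 1 ∉ z then -coeffMat P 0
  else 1

open Classical in
/-- The last diagonal block of `L`: `-A_0` if `-0, -1 ∈ z` with `-0` to the left of `-1`;
otherwise `I_n`. -/
def L₂ {n : ℕ} (P : Matrix (Fin n) (Fin n) F[X]) (z : List ℕ) : Matrix (Fin n) (Fin n) F :=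
  if LeftOf 0 1 z then -coeffMat P 0 else 1

open Classical in
/-- The first diagonal block of `R`: `A_k` if `k, k-1 ∈ q` with `k` to the right of `k-1`, or if
`k ∈ q` and `k-1 ∉ q`; otherwise `I_n`. -/
def R₁ {n : ℕ} (k : ℕ) (P : Matrix (Fin n) (Fin n) F[X]) (q : List ℕ) :
    Matrix (Fin n) (Fin n) F :=
  if LeftOf (k - 1) k q then coeffMat P k
  else if k ∈ q ∧ k - 1 ∉ q then coeffMat P k
  else 1

open Classical in
/-- The first diagonal block of `L`: `A_k` if `k, k-1 ∈ q` with `k` to the left of `k-1`;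
otherwise `I_n`. -/
def L₁ {n : ℕ} (k : ℕ) (P : Matrix (Fin n) (Fin n) F[X]) (q : List ℕ) :
    Matrix (Fin n) (Fin n) F :=
  if LeftOf k (k - 1) q then coeffMat P k else 1

/-- `L = diag(L₁, I_n, …, I_n, L₂)`. -/
def leftFactor {n : ℕ} (k : ℕ) (P : Matrix (Fin n) (Fin n) F[X]) (q z : List ℕ) :
    Matrix (Fin k × Fin n) (Fin k × Fin n) F :=
  cornerDiag k (L₁ k P q) (L₂ P z)

/-- `R = diag(R₁, I_n, …, I_n, R₂)`. -/
def rightFactor {n : ℕ} (k : ℕ) (P : Matrix (Fin n) (Fin n) F[X]) (q z : List ℕ) :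
    Matrix (Fin k × Fin n) (Fin k × Fin n) F :=
  cornerDiag k (R₁ k P q) (R₂ P z)

/-! ### Block Kronecker pencils and the antidiagonal sum condition -/

/-- The `s × (s + 1)` pencil `L_s(λ)` with `-1` on the diagonal and `λ` on the superdiagonal. -/
def Lpencil (F : Type*) [Field F] (s : ℕ) : Matrix (Fin s) (Fin (s + 1)) F[X] :=
  fun i j => if j = i.castSucc then -1 else if j = i.succ then X else 0

/-- The block matrix `[M, L_q(λ)ᵀ ⊗ I_n; L_p(λ) ⊗ I_n, 0]`. -/
def blockKronecker {n : ℕ} (p q : ℕ) (M : Matrix (Fin (q + 1) × Fin n) (Fin (p + 1) × Fin n) F[X]) :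
    Matrix ((Fin (q + 1) × Fin n) ⊕ (Fin p × Fin n)) ((Fin (p + 1) × Fin n) ⊕ (Fin q × Fin n))
      F[X] :=
  Matrix.fromBlocks M ((Lpencil F q)ᵀ ⊗ₖ (1 : Matrix (Fin n) (Fin n) F[X]))
    (Lpencil F p ⊗ₖ (1 : Matrix (Fin n) (Fin n) F[X])) 0

/-- The order-preserving identification of the `a` block indices of a first group followed by the
`b` block indices of a second group with the `k = a + b` block indices of the whole matrix. -/
def split (n : ℕ) {a b k : ℕ} (h : a + b = k) :
    (Fin a × Fin n) ⊕ (Fin b × Fin n) ≃ Fin k × Fin n :=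
  (Equiv.sumProdDistrib (Fin a) (Fin b) (Fin n)).symm.trans
    ((finSumFinEquiv.trans (finCongr h)).prodCongr (Equiv.refl (Fin n)))

/-- `C` is a `(p, n, q, n)`-block Kronecker pencil with body the pencil `M`. -/
def IsBlockKroneckerPencil {k n : ℕ} (p q : ℕ) (C : Matrix (Fin k × Fin n) (Fin k × Fin n) F[X])
    (M : Matrix (Fin (q + 1) × Fin n) (Fin (p + 1) × Fin n) F[X]) : Prop :=
  HasGrade 1 M ∧ ∃ (hr : q + 1 + p = k) (hc : p + 1 + q = k),
    C = Matrix.reindex (split n hr) (split n hc) (blockKronecker p q M)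

/-- The antidiagonal sum `AS(M, s) = ∑_{i+j=k+2-s} [M₁]_{ij} + ∑_{i+j=k+1-s} [M₀]_{ij}` of
`M = λ M₁ + M₀`, where `k = p + q + 1` and the block indices `i, j` in these sums are `1`-based. -/
def antidiagSum {n p q : ℕ} (M : Matrix (Fin (q + 1) × Fin n) (Fin (p + 1) × Fin n) F[X]) (s : ℕ) :
    Matrix (Fin n) (Fin n) F :=
  (∑ i : Fin (q + 1), ∑ j : Fin (p + 1),
      if ((i : ℕ) + 1) + ((j : ℕ) + 1) + s = (p + q + 1) + 2 then blk (coeffMat M 1) i j else 0) +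
    ∑ i : Fin (q + 1), ∑ j : Fin (p + 1),
      if ((i : ℕ) + 1) + ((j : ℕ) + 1) + s = (p + q + 1) + 1 then blk (coeffMat M 0) i j else 0

/-- `M` satisfies the antidiagonal sum condition for `P = ∑_{i ≤ k} A_i λ^i`, `k = p + q + 1`:
`AS(M, s) = A_s` for `s = 0, …, k`. -/
def ASCondition {n p q : ℕ} (M : Matrix (Fin (q + 1) × Fin n) (Fin (p + 1) × Fin n) F[X])
    (P : Matrix (Fin n) (Fin n) F[X]) : Prop :=
  ∀ s ≤ p + q + 1, antidiagSum M s = coeffMat P s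

end

end Fiedler

namespace Fiedler

/-! ### The order of the entries of a tuple -/

/-! Number the block indices by wires 1, …, k, wire w being the 0-based block index k - w. For 1 ≤ i
≤ k - 1, M_i and M_{-i} act only on the wires i and i+1: with zero coefficient both swap them, and
the coefficient is an extra diagonal block, on wire i+1 for M_i and on wire i for M_{-i}.

Reduction to proper pencils. M_{-0}^P acts on wire 1 only, as (-A_0)⁻¹, so it commutes with every
factor of M_z^P except M_{-1}^P. It can therefore be slid to the end of M_z^P at which L or R
carries the corner -A_0. There the two cancel, while the same corner attaches M_0^P to M_q^P. Thus 0
passes from z to q (`exists_tuples_zero_mem`). In the same way k passes from q to z, with k-1 as the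
only obstruction (`exists_tuples_top_mem`).

Proper pencils. A unit block-column that meets no coefficient travels through a product along a path
dictated by the relative order of consecutive indices. Consequently each coefficient enters the
product linearly, in a single block found by following one column path and one row path
(`exists_posProd_eq_add_sum` and its negative twin). `Body` separates the body rows from the linking
ones; reversing the tuples does so for columns. Both products send a linking column to a unit column
in a body row.

Positions are measured by `countAbove`. The key identity `countAbove_body` says that above a wire c
there are as many body rows as linking columns, plus one if c ∈ q. Hence the j-th linking column
carries -1 in body row j and λ in body row j+1, which is the block L_qᵀ ⊗ I; transposition gives L_p
⊗ I. Counting columns as body or linking turns the identity into `countAbove_body_add`, which puts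
A_t at 0-based body positions of sum k - t in M_1 if t ∈ z, and of sum k - t - 1 in M_0 if t ∈ q.
This is the AS condition. -/

theorem leftOf_iff_sublist {a b : ℕ} {l : List ℕ} (hl : l.Nodup) :
    LeftOf a b l ↔ [a, b].Sublist l := by
  induction l with
  | nil => simp [LeftOf]
  | cons x l ih =>
    obtain ⟨hx, hl⟩ := List.nodup_cons.1 hl
    rw [List.cons_sublist_cons', ← ih hl, List.singleton_sublist]
    by_cases ha : a = x
    · subst ha
      by_cases hb : b = a
      · subst hb; simp [LeftOf, hx]
      · simp [LeftOf, hx, hb, List.idxOf_cons_ne _ (Ne.symm hb)]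
    · by_cases hb : b = x
      · subst hb; simp [LeftOf, hx, ha]
      · simp [LeftOf, ha, hb, List.idxOf_cons_ne _ (Ne.symm ha), List.idxOf_cons_ne _ (Ne.symm hb)]

theorem leftOf_cons {a b x : ℕ} {l : List ℕ} (hl : (x :: l).Nodup) :
    LeftOf a b (x :: l) ↔ LeftOf a b l ∨ (a = x ∧ b ∈ l) := by
  rw [leftOf_iff_sublist hl, leftOf_iff_sublist (List.nodup_cons.1 hl).2,
    List.cons_sublist_cons', List.singleton_sublist]

theorem leftOf_reverse {a b : ℕ} {l : List ℕ} (hl : l.Nodup) :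
    LeftOf a b l.reverse ↔ LeftOf b a l := by
  rw [leftOf_iff_sublist hl, leftOf_iff_sublist (List.nodup_reverse.2 hl),
    ← List.reverse_sublist]
  simp

theorem leftOf_or {a b : ℕ} {l : List ℕ} (ha : a ∈ l) (hb : b ∈ l) (hab : a ≠ b) :
    LeftOf a b l ∨ LeftOf b a l := by
  have : l.idxOf a ≠ l.idxOf b := fun h => hab ((List.idxOf_inj ha).1 h)
  rcases lt_or_gt_of_ne this with h | h
  · exact Or.inl ⟨ha, hb, h⟩
  · exact Or.inr ⟨hb, ha, h⟩

theorem LeftOf.asymm {a b : ℕ} {l : List ℕ} (h : LeftOf a b l) : ¬ LeftOf b a l :=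
  fun h' => lt_asymm h.2.2 h'.2.2

/-- The tuple `(k - t₁, …, k - t_r)`. -/
def reflect (k : ℕ) (l : List ℕ) : List ℕ := l.map fun i => k - i

theorem reflect_reflect {k : ℕ} {l : List ℕ} (hl : ∀ i ∈ l, i ≤ k) :
    reflect k (reflect k l) = l := by
  unfold reflect
  rw [List.map_map]
  conv_rhs => rw [← List.map_id l]
  refine List.map_congr_left fun i hi => ?_
  have := hl i hi
  simp only [Function.comp, id]
  omega

theorem reflect_nodup {k : ℕ} {l : List ℕ} (hl : ∀ i ∈ l, i ≤ k) (h : l.Nodup) :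
    (reflect k l).Nodup := by
  refine List.Nodup.map_on (fun x hx y hy hxy => ?_) h
  have := hl x hx
  have := hl y hy
  omega

theorem reflect_le {k : ℕ} {l : List ℕ} : ∀ i ∈ reflect k l, i ≤ k := by
  intro i hi
  obtain ⟨j, -, rfl⟩ := List.mem_map.1 hi
  omega

theorem mem_reflect {k i : ℕ} {l : List ℕ} (hl : ∀ i ∈ l, i ≤ k) (hi : i ≤ k) :
    i ∈ reflect k l ↔ k - i ∈ l := by
  constructor
  · intro h
    obtain ⟨j, hj, rfl⟩ := List.mem_map.1 h
    have := hl j hj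
    rwa [Nat.sub_sub_self this]
  · intro h
    exact List.mem_map.2 ⟨_, h, Nat.sub_sub_self hi⟩

theorem leftOf_reflect {k a b : ℕ} {l : List ℕ} (hl : ∀ i ∈ l, i ≤ k) (h : l.Nodup)
    (ha : a ≤ k) (hb : b ≤ k) : LeftOf a b (reflect k l) ↔ LeftOf (k - a) (k - b) l := by
  rw [leftOf_iff_sublist h, leftOf_iff_sublist (reflect_nodup hl h)]
  constructor
  · intro h'
    have h2 : (reflect k [a, b]).Sublist (reflect k (reflect k l)) := h'.map _
    rwa [reflect_reflect hl] at h2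
  · intro h'
    have := h'.map fun i => k - i
    simpa [reflect, Nat.sub_sub_self ha, Nat.sub_sub_self hb] using this

/-! ### Unit block-columns and elementary matrices -/

variable {F : Type*} [Field F] {k n : ℕ}

/-- The block-column with `I_n` in the block-row `k - w` (`0`-based), zero if there is no such
block-row. -/
def unitCol (F : Type*) [Field F] (k n w : ℕ) : Matrix (Fin k × Fin n) (Fin n) F :=
  fun x b => if (x.1 : ℕ) + w = k ∧ x.2 = b then 1 else 0

theorem unitCol_eq_zero {w : ℕ} (h : ¬ (1 ≤ w ∧ w ≤ k)) : unitCol F k n w = 0 := by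
  ext x b
  have := x.1.2
  simp only [unitCol, Matrix.zero_apply, ite_eq_right_iff]
  intro h'
  omega

theorem mul_unitCol_apply {ι : Type*} (H : Matrix ι (Fin k × Fin n) F) {w : ℕ} (s : Fin k)
    (h : (s : ℕ) + w = k) (x : ι) (b : Fin n) : (H * unitCol F k n w) x b = H x (s, b) := by
  rw [Matrix.mul_apply, Finset.sum_eq_single (s, b)]
  · simp [unitCol, h]
  · intro y _ hy
    have : ¬ ((y.1 : ℕ) + w = k ∧ y.2 = b) := by
      rintro ⟨h1, h2⟩
      exact hy (Prod.ext (Fin.ext (by simp; omega)) h2)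
    simp [unitCol, this]
  · simp

theorem exists_wire {w : ℕ} (h1 : 1 ≤ w) (h2 : w ≤ k) : ∃ s : Fin k, (s : ℕ) + w = k :=
  ⟨⟨k - w, by omega⟩, by simp; omega⟩

theorem elemPosCore_mul_unitCol_of_ne {i w : ℕ} (B : Matrix (Fin n) (Fin n) F) (h1 : w ≠ i)
    (h2 : w ≠ i + 1) : elemPosCore k i B * unitCol F k n w = unitCol F k n w := by
  by_cases hw : 1 ≤ w ∧ w ≤ k
  · obtain ⟨s, hs⟩ := exists_wire hw.1 hw.2
    ext x b
    rw [mul_unitCol_apply _ s hs]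
    simp only [elemPosCore, ofBlocks, unitCol]
    rw [if_neg (by omega), if_neg (by omega), if_neg (by omega), if_neg (by omega)]
    by_cases hx : x.1 = s
    · simp [hx, hs, Matrix.one_apply]
    · have : ¬ ((x.1 : ℕ) + w = k) := fun h => hx (Fin.ext (by omega))
      simp [hx, this]
  · rw [unitCol_eq_zero hw, Matrix.mul_zero]

/-- Wire `i` meets the column `(I, 0)` of the active block, so it is lifted without seeing `B`. For
`i = 0` the left side vanishes, since there is no wire 0. -/
theorem elemPosCore_mul_unitCol_self {i : ℕ} (B : Matrix (Fin n) (Fin n) F) (hi : 1 ≤ i) :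
    elemPosCore k i B * unitCol F k n i = unitCol F k n (i + 1) := by
  by_cases hw : i ≤ k
  · obtain ⟨s, hs⟩ := exists_wire hi hw
    ext x b
    rw [mul_unitCol_apply _ s hs]
    simp only [elemPosCore, ofBlocks, unitCol]
    have hx := x.1.2
    rw [if_neg (by omega)]
    by_cases h1 : (x.1 : ℕ) + i + 1 = k
    · rw [if_pos ⟨h1, hs⟩]
      simp [← add_assoc, h1, Matrix.one_apply]
    · rw [if_neg (by omega), if_neg (by omega)]
      have hx : x.1 = s → (x.1 : ℕ) + i = k := fun h => by rw [h, hs]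
      by_cases h2 : (x.1 : ℕ) + i = k
      · simp [h2, hs, ← add_assoc]
      · have h3 : ¬ x.1 = s := fun h => h2 (hx h)
        simp [h3, ← add_assoc, h1, h2]
  · rw [unitCol_eq_zero (by omega), unitCol_eq_zero (by omega), Matrix.mul_zero]

theorem unitCol_mul_mul_unitCol_apply {w v : ℕ} (B : Matrix (Fin n) (Fin n) F)
    (x y : Fin k × Fin n) :
    (unitCol F k n w * B * (unitCol F k n v)ᵀ) x y =
      if (x.1 : ℕ) + w = k ∧ (y.1 : ℕ) + v = k then B x.2 y.2 else 0 := by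
  have h1 : ∀ b, (unitCol F k n w * B) x b = if (x.1 : ℕ) + w = k then B x.2 b else 0 := by
    intro b
    rw [Matrix.mul_apply, Finset.sum_eq_single x.2]
    · simp [unitCol]
    · intro c _ hc
      simp [unitCol, Ne.symm hc]
    · simp
  rw [Matrix.mul_apply, Finset.sum_eq_single y.2]
  · rw [h1]
    simp only [unitCol, Matrix.transpose_apply]
    split_ifs <;> simp_all
  · intro c _ hc
    simp [unitCol, Ne.symm hc]
  · simp

/-- Isolates the coefficient between a unit column and a unit row, so that a product can be expanded
one coefficient at a time. -/
theorem elemPosCore_eq_add {i : ℕ} (B : Matrix (Fin n) (Fin n) F) :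
    elemPosCore k i B = elemPosCore k i 0 +
      unitCol F k n (i + 1) * B * (unitCol F k n (i + 1))ᵀ := by
  ext x y
  rw [Matrix.add_apply, unitCol_mul_mul_unitCol_apply]
  simp only [elemPosCore, ofBlocks, ← add_assoc]
  split_ifs <;> simp

theorem elemPosCore_transpose (i : ℕ) (B : Matrix (Fin n) (Fin n) F) :
    (elemPosCore k i B)ᵀ = elemPosCore k i Bᵀ := by
  ext x y
  simp only [elemPosCore, ofBlocks, Matrix.transpose_apply, and_comm (a := (y.1 : ℕ) + i + 1 = k),
    and_comm (a := (y.1 : ℕ) + i = k), eq_comm (a := y.1)]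
  split_ifs <;> first | rfl | omega | simp [Matrix.one_apply, eq_comm]

/-- Reversal of the order of the block indices. -/
def revEquiv (k n : ℕ) : Fin k × Fin n ≃ Fin k × Fin n :=
  Fin.revPerm.prodCongr (Equiv.refl _)

/-- Reversing the block order exchanges the wires `w` and `k + 1 - w`. Through this every statement
on negative indices is deduced from one on positive indices. -/
theorem elemNegCore_eq_submatrix {i : ℕ} (hi : i ≤ k) (B : Matrix (Fin n) (Fin n) F) :
    elemNegCore k i B = (elemPosCore k (k - i) B).submatrix (revEquiv k n) (revEquiv k n) := by
  ext x y
  have hx := x.1.2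
  have hy := y.1.2
  have e1 : ∀ u : Fin k, ((k - (u + 1) + (k - i) + 1 = k) ↔ ((u : ℕ) + i = k)) := by
    intro u; have := u.2; omega
  have e2 : ∀ u : Fin k, ((k - (u + 1) + (k - i) = k) ↔ ((u : ℕ) + i + 1 = k)) := by
    intro u; have := u.2; omega
  simp only [elemNegCore, elemPosCore, ofBlocks, Matrix.submatrix_apply, revEquiv,
    Equiv.prodCongr_apply, Prod.map, Fin.revPerm_apply, Fin.val_rev, Equiv.refl_apply, e1, e2,
    Fin.rev_inj]
  split_ifs <;> first | rfl | omega

theorem elemNegCore_transpose {i : ℕ} (hi : i ≤ k) (B : Matrix (Fin n) (Fin n) F) :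
    (elemNegCore k i B)ᵀ = elemNegCore k i Bᵀ := by
  rw [elemNegCore_eq_submatrix hi, elemNegCore_eq_submatrix hi, Matrix.transpose_submatrix,
    elemPosCore_transpose]

theorem unitCol_submatrix {w : ℕ} (hw : w ≤ k + 1) :
    (unitCol F k n w).submatrix (revEquiv k n) id = unitCol F k n (k + 1 - w) := by
  ext x b
  have hx := x.1.2
  have : (k - (x.1 + 1) + w = k) ↔ ((x.1 : ℕ) + (k + 1 - w) = k) := by omega
  simp [unitCol, revEquiv, Fin.val_rev, this]

end Fiedler

namespace Fiedler

/-! ### Products of elementary matrices -/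

/-- `d` is the first index above `i` such that `d` is not to the left of `d - 1` in `l`. -/
structure FirstAbove (l : List ℕ) (i d : ℕ) : Prop where
  lt : i < d
  leftOf : ∀ w, i < w → w < d → LeftOf w (w - 1) l
  not_leftOf : ¬ LeftOf d (d - 1) l

theorem FirstAbove.pred_mem {l : List ℕ} {i d : ℕ} (h : FirstAbove l i d) (hi : i ∈ l) :
    d - 1 ∈ l := by
  by_cases hd : i = d - 1
  · rwa [← hd]
  · have := h.lt
    exact (h.leftOf (d - 1) (by omega) (by omega)).1

variable {F : Type*} [Field F] {k n : ℕ}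

/-- The product of the matrices `M_i(A_i)` in the order of the tuple `l`. -/
def posProd (k : ℕ) (A : ℕ → Matrix (Fin n) (Fin n) F) (l : List ℕ) :
    Matrix (Fin k × Fin n) (Fin k × Fin n) F :=
  (l.map fun i => elemPosCore k i (A i)).prod

theorem posProd_cons (A : ℕ → Matrix (Fin n) (Fin n) F) (a : ℕ) (l : List ℕ) :
    posProd k A (a :: l) = elemPosCore k a (A a) * posProd k A l := by
  simp [posProd]

theorem posProd_transpose (A : ℕ → Matrix (Fin n) (Fin n) F) (l : List ℕ) :
    (posProd k A l)ᵀ = posProd k (fun i => (A i)ᵀ) l.reverse := by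
  rw [posProd, Matrix.transpose_list_prod, posProd, List.map_map, ← List.map_reverse]
  simp [Function.comp_def, elemPosCore_transpose]

/-- A new leftmost factor moves the column only when `a = d`. The factor that would bring in a
coefficient has index `d - 1`, which already occurs in `l`. -/
theorem FirstAbove.step (A : ℕ → Matrix (Fin n) (Fin n) F) {a i d : ℕ} {l : List ℕ}
    (h : FirstAbove l i d) (hl : (a :: l).Nodup) (hi : i ∈ l) :
    ∃ d', FirstAbove (a :: l) i d' ∧
      elemPosCore k a (A a) * unitCol F k n d = unitCol F k n d' := by
  have hp := h.pred_mem hi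
  have hlt := h.lt
  have ha := (List.nodup_cons.1 hl).1
  by_cases had : a = d
  · subst had
    refine ⟨a + 1, ⟨by omega, fun w h1 h2 => ?_, ?_⟩,
      elemPosCore_mul_unitCol_self _ (by omega)⟩
    · rw [leftOf_cons hl]
      by_cases hw : w = a
      · subst hw; exact Or.inr ⟨rfl, hp⟩
      · exact Or.inl (h.leftOf w h1 (by omega))
    · rw [leftOf_cons hl]
      rintro (h' | h')
      · exact ha h'.2.1
      · omega
  · have had' : a ≠ d - 1 := fun h => ha (h ▸ hp)
    refine ⟨d, ⟨hlt, fun w h1 h2 => ?_, ?_⟩, elemPosCore_mul_unitCol_of_ne _ (Ne.symm had)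
      (by omega)⟩
    · rw [leftOf_cons hl]
      exact Or.inl (h.leftOf w h1 h2)
    · rw [leftOf_cons hl]
      rintro (h' | h')
      · exact h.not_leftOf h'
      · exact had h'.1.symm

theorem posProd_mul_unitCol_of_notMem (A : ℕ → Matrix (Fin n) (Fin n) F) {i : ℕ} {l : List ℕ}
    (h1 : i ∉ l) (h2 : i - 1 ∉ l) (hi : 1 ≤ i) :
    posProd k A l * unitCol F k n i = unitCol F k n i := by
  induction l with
  | nil => simp [posProd]
  | cons a l ih =>
    rw [List.mem_cons, not_or] at h1 h2
    rw [posProd_cons, Matrix.mul_assoc, ih h1.2 h2.2,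
      elemPosCore_mul_unitCol_of_ne _ h1.1 (by omega)]

/-- Factors act from right to left: `M_i` lifts the column to wire `i + 1`, then `M_{i+1}` lifts it
again if it stands further left, and so on. The hypothesis `h` prevents `M_{i-1}` from acting first,
which would bring in a coefficient. -/
theorem exists_posProd_mul_unitCol (A : ℕ → Matrix (Fin n) (Fin n) F) {i : ℕ} {l : List ℕ}
    (hl : l.Nodup) (hil : i ∈ l) (hi : 1 ≤ i) (h : ¬ LeftOf i (i - 1) l) :
    ∃ d, FirstAbove l i d ∧ posProd k A l * unitCol F k n i = unitCol F k n d := by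
  induction l with
  | nil => simp at hil
  | cons a l ih =>
    have hl' := (List.nodup_cons.1 hl)
    rw [leftOf_cons hl, not_or] at h
    by_cases hi' : i ∈ l
    · obtain ⟨d, hd, hd'⟩ := ih hl'.2 hi' h.1
      rw [posProd_cons, Matrix.mul_assoc, hd']
      exact hd.step A hl hi'
    · have hia : i = a := by simpa [hi'] using hil
      subst hia
      have h2 : i - 1 ∉ l := fun h' => h.2 ⟨rfl, h'⟩
      rw [posProd_cons, Matrix.mul_assoc, posProd_mul_unitCol_of_notMem A hi' h2 hi,
        elemPosCore_mul_unitCol_self _ hi]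
      refine ⟨i + 1, ⟨by omega, fun w _ _ => by omega, fun h' => ?_⟩, rfl⟩
      rcases (leftOf_cons hl).1 h' with h' | h'
      · exact hi' h'.2.1
      · omega

theorem exists_posProd_mul_unitCol_succ (A : ℕ → Matrix (Fin n) (Fin n) F) {a : ℕ} {l : List ℕ}
    (hl : (l ++ [a]).Nodup) :
    ∃ d, FirstAbove (l ++ [a]) a d ∧
      posProd k A l * unitCol F k n (a + 1) = unitCol F k n d := by
  induction l with
  | nil =>
    refine ⟨a + 1, ⟨by omega, fun w _ _ => by omega, fun h' => ?_⟩, by simp [posProd]⟩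
    have := h'.1
    simp at this
  | cons b l ih =>
    obtain ⟨d, hd, hd'⟩ := ih (List.nodup_cons.1 hl).2
    rw [posProd_cons, Matrix.mul_assoc, hd']
    exact hd.step A hl (by simp)

/-- Follows the row factor of the coefficient of `M_a` through the factors to its right. Keeping `a`
in the tuple of `FirstAbove` lets the path refer to the whole product. -/
theorem exists_unitCol_transpose_mul_posProd (A : ℕ → Matrix (Fin n) (Fin n) F) {a : ℕ}
    {l : List ℕ} (hl : (a :: l).Nodup) :
    ∃ d, FirstAbove (a :: l).reverse a d ∧
      (unitCol F k n (a + 1))ᵀ * posProd k A l = (unitCol F k n d)ᵀ := by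
  rw [← List.nodup_reverse, List.reverse_cons] at hl
  obtain ⟨d, hd, hd'⟩ := exists_posProd_mul_unitCol_succ (k := k) (fun i => (A i)ᵀ) hl
  refine ⟨d, by rwa [List.reverse_cons], ?_⟩
  rw [← hd', Matrix.transpose_mul, posProd_transpose]
  simp

theorem FirstAbove.reverse_cons {a i d : ℕ} {l : List ℕ} (h : FirstAbove l.reverse i d)
    (hl : (a :: l).Nodup) (hi : i ∈ l) : FirstAbove (a :: l).reverse i d := by
  have hl' := List.nodup_cons.1 hl
  refine ⟨h.lt, fun w h1 h2 => ?_, ?_⟩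
  · rw [leftOf_reverse hl, leftOf_cons hl]
    exact Or.inl ((leftOf_reverse hl'.2).1 (h.leftOf w h1 h2))
  · rw [leftOf_reverse hl, leftOf_cons hl, ← leftOf_reverse hl'.2]
    rintro (h' | h')
    · exact h.not_leftOf h'
    · have := h.pred_mem (List.mem_reverse.2 hi)
      rw [h'.1, List.mem_reverse] at this
      exact hl'.1 this

/-- Two coefficients are never multiplied: the coefficient of a new factor `M_a` meets the rest of
the product through a unit row, which stays a unit row, and the old terms meet `M_a` through unit
columns that do not see its coefficient. -/
theorem exists_posProd_eq_add_sum (A : ℕ → Matrix (Fin n) (Fin n) F) {l : List ℕ}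
    (hl : l.Nodup) :
    ∃ ρ γ : ℕ → ℕ, (∀ i ∈ l, FirstAbove l i (ρ i) ∧ FirstAbove l.reverse i (γ i)) ∧
      posProd k A l = posProd k 0 l +
        ∑ i ∈ l.toFinset, unitCol F k n (ρ i) * A i * (unitCol F k n (γ i))ᵀ := by
  induction l with
  | nil => exact ⟨id, id, by simp, by simp [posProd]⟩
  | cons a l ih =>
    have hl' := List.nodup_cons.1 hl
    obtain ⟨ρ, γ, h, hA⟩ := ih hl'.2
    obtain ⟨c, hc, hcA⟩ := exists_unitCol_transpose_mul_posProd (k := k) A hl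
    have hstep : ∀ i, ∃ d', i ∈ l → FirstAbove (a :: l) i d' ∧
        elemPosCore k a (0 : Matrix (Fin n) (Fin n) F) * unitCol F k n (ρ i) =
          unitCol F k n d' := by
      intro i
      by_cases hi : i ∈ l
      · obtain ⟨d', hd'⟩ := (h i hi).1.step (k := k) (n := n) (F := F) 0 hl hi
        exact ⟨d', fun _ => hd'⟩
      · exact ⟨0, fun h => absurd h hi⟩
    choose ρ' hρ' using hstep
    have hne : ∀ i ∈ l, i ≠ a := fun i hi h => hl'.1 (h ▸ hi)
    have hf : FirstAbove (a :: l) a (a + 1) := by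
      refine ⟨by omega, fun w _ _ => by omega, fun h' => ?_⟩
      rcases (leftOf_cons hl).1 h' with h' | h'
      · exact hl'.1 h'.2.1
      · omega
    refine ⟨fun i => if i = a then a + 1 else ρ' i, fun i => if i = a then c else γ i, ?_, ?_⟩
    · intro i hi
      rcases List.mem_cons.1 hi with rfl | hi
      · simpa using ⟨hf, by simpa using hc⟩
      · simp only [if_neg (hne i hi)]
        exact ⟨(hρ' i hi).1, (h i hi).2.reverse_cons hl hi⟩
    · rw [List.toFinset_cons, Finset.sum_insert (by simpa using hl'.1), posProd_cons, posProd_cons,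
        elemPosCore_eq_add, Matrix.add_mul, Matrix.mul_assoc _ _ (posProd k A l), hcA]
      conv_lhs => rw [hA]
      rw [Matrix.mul_add, Matrix.mul_sum, add_assoc, add_comm (∑ i ∈ _, _)]
      simp only [if_true, Pi.zero_apply]
      congr 2
      refine Finset.sum_congr rfl fun i hi => ?_
      have hi : i ∈ l := by simpa using hi
      rw [if_neg (hne i hi), if_neg (hne i hi), ← (hρ' i hi).2]
      simp only [Matrix.mul_assoc]

end Fiedler

namespace Fiedler

/-! ### Products of elementary matrices with negative indices -/

variable {F : Type*} [Field F] {k n : ℕ}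

/-- The product of the matrices `M_{-i}(A_i)` in the order of the tuple `l` of absolute values. -/
def negProd (k : ℕ) (A : ℕ → Matrix (Fin n) (Fin n) F) (l : List ℕ) :
    Matrix (Fin k × Fin n) (Fin k × Fin n) F :=
  (l.map fun i => elemNegCore k i (A i)).prod

theorem negProd_eq_submatrix (A : ℕ → Matrix (Fin n) (Fin n) F) {l : List ℕ}
    (hl : ∀ i ∈ l, i ≤ k) :
    negProd k A l = (posProd k (fun i => A (k - i)) (reflect k l)).submatrix
      (revEquiv k n) (revEquiv k n) := by
  induction l with
  | nil => simp [negProd, posProd, reflect]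
  | cons a l ih =>
    have ha : a ≤ k := hl a (by simp)
    have ih := ih fun i hi => hl i (by simp [hi])
    have h1 : reflect k (a :: l) = (k - a) :: reflect k l := rfl
    have h2 : negProd k A (a :: l) = elemNegCore k a (A a) * negProd k A l := by simp [negProd]
    rw [h1, h2, posProd_cons, ← Matrix.submatrix_mul_equiv _ _ _ (revEquiv k n), ← ih,
      elemNegCore_eq_submatrix ha, Nat.sub_sub_self ha]

theorem negProd_transpose (A : ℕ → Matrix (Fin n) (Fin n) F) {l : List ℕ}
    (hl : ∀ i ∈ l, i ≤ k) :
    (negProd k A l)ᵀ = negProd k (fun i => (A i)ᵀ) l.reverse := by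
  rw [negProd_eq_submatrix A hl, Matrix.transpose_submatrix, posProd_transpose,
    negProd_eq_submatrix _ (by simpa using hl)]
  simp [reflect]

theorem negProd_mul_unitCol (A : ℕ → Matrix (Fin n) (Fin n) F) {l : List ℕ}
    (hl : ∀ i ∈ l, i ≤ k) {w : ℕ} (hw : w ≤ k + 1) :
    negProd k A l * unitCol F k n w =
      (posProd k (fun i => A (k - i)) (reflect k l) * unitCol F k n (k + 1 - w)).submatrix
        (revEquiv k n) id := by
  rw [negProd_eq_submatrix A hl, ← Matrix.submatrix_mul_equiv _ _ _ (revEquiv k n),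
    unitCol_submatrix (by omega), Nat.sub_sub_self hw]

/-- `d` is the last index `≤ i` such that `d - 1` is not to the left of `d` in `l`, or `0`. -/
structure FirstBelow (l : List ℕ) (i d : ℕ) : Prop where
  le : d ≤ i
  leftOf : ∀ w, d < w → w ≤ i → LeftOf (w - 1) w l
  not_leftOf : ¬ LeftOf (d - 1) d l

theorem FirstAbove.reflect {l : List ℕ} (hl : ∀ i ∈ l, i ≤ k) (hn : l.Nodup) {i d : ℕ}
    (hi : i ∈ l) (h : FirstAbove (reflect k l) (k - i) d) :
    d ≤ k + 1 ∧ FirstBelow l i (k + 1 - d) := by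
  have hik := hl i hi
  have hp := h.pred_mem ((mem_reflect hl (by omega)).2 (by rwa [Nat.sub_sub_self hik]))
  have hd := reflect_le _ hp
  have hlt := h.lt
  refine ⟨by omega, by omega, fun w h1 h2 => ?_, fun h' => ?_⟩
  · have := h.leftOf (k + 1 - w) (by omega) (by omega)
    rw [leftOf_reflect hl hn (by omega) (by omega)] at this
    convert this using 1 <;> omega
  · by_cases hdk : d = k + 1
    · subst hdk
      exact absurd h'.2.2 (by simp)
    · refine h.not_leftOf ?_
      rw [leftOf_reflect hl hn (by omega) (by omega)]
      convert h' using 1 <;> omega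

theorem negProd_mul_unitCol_of_notMem (A : ℕ → Matrix (Fin n) (Fin n) F) {l : List ℕ}
    (hl : ∀ i ∈ l, i ≤ k) {w : ℕ} (h1 : w ∉ l) (h2 : w - 1 ∉ l) (hw : 1 ≤ w) (hwk : w ≤ k) :
    negProd k A l * unitCol F k n w = unitCol F k n w := by
  rw [negProd_mul_unitCol A hl (by omega), posProd_mul_unitCol_of_notMem, unitCol_submatrix,
    Nat.sub_sub_self (by omega)]
  · omega
  · rwa [mem_reflect hl (by omega), show k - (k + 1 - w) = w - 1 by omega]
  · rwa [mem_reflect hl (by omega), show k - (k + 1 - w - 1) = w by omega]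
  · omega

theorem exists_negProd_mul_unitCol (A : ℕ → Matrix (Fin n) (Fin n) F) {l : List ℕ}
    (hl : ∀ i ∈ l, i ≤ k) (hn : l.Nodup) {i : ℕ} (hi : i ∈ l) (hik : i < k)
    (h : ¬ LeftOf i (i + 1) l) :
    ∃ d, FirstBelow l i d ∧ negProd k A l * unitCol F k n (i + 1) = unitCol F k n d := by
  obtain ⟨d, hd, hd'⟩ := exists_posProd_mul_unitCol (k := k) (fun i => A (k - i))
    (l := reflect k l) (i := k - i) (reflect_nodup hl hn)
    ((mem_reflect hl (by omega)).2 (by rwa [Nat.sub_sub_self hik.le])) (by omega)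
    (by rwa [leftOf_reflect hl hn (by omega) (by omega), Nat.sub_sub_self hik.le,
      show k - (k - i - 1) = i + 1 by omega])
  obtain ⟨h1, h2⟩ := hd.reflect hl hn hi
  refine ⟨_, h2, ?_⟩
  rw [negProd_mul_unitCol A hl (by omega), show k + 1 - (i + 1) = k - i by omega, hd',
    unitCol_submatrix h1]

theorem exists_negProd_eq_add_sum (A : ℕ → Matrix (Fin n) (Fin n) F) {l : List ℕ}
    (hl : ∀ i ∈ l, i ≤ k) (hn : l.Nodup) :
    ∃ ρ γ : ℕ → ℕ, (∀ i ∈ l, FirstBelow l i (ρ i) ∧ FirstBelow l.reverse i (γ i)) ∧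
      negProd k A l = negProd k 0 l +
        ∑ i ∈ l.toFinset, unitCol F k n (ρ i) * A i * (unitCol F k n (γ i))ᵀ := by
  obtain ⟨ρ, γ, h, hA⟩ := exists_posProd_eq_add_sum (k := k) (fun i => A (k - i))
    (reflect_nodup hl hn)
  have hr : ∀ i ∈ l, k - i ∈ reflect k l := fun i hi =>
    (mem_reflect hl (by omega)).2 (by rwa [Nat.sub_sub_self (hl i hi)])
  have hrev : (reflect k l).reverse = reflect k l.reverse := by simp [reflect]
  have h1 := fun i hi => (h (k - i) (hr i hi)).1.reflect hl hn hi
  have h2 : ∀ i ∈ l, _ := fun i hi =>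
    (hrev ▸ (h (k - i) (hr i hi)).2).reflect (l := l.reverse) (by simpa using hl)
      (List.nodup_reverse.2 hn) (by simpa using hi)
  refine ⟨fun i => k + 1 - ρ (k - i), fun i => k + 1 - γ (k - i),
    fun i hi => ⟨(h1 i hi).2, (h2 i hi).2⟩, ?_⟩
  rw [negProd_eq_submatrix A hl, negProd_eq_submatrix 0 hl, hA]
  ext x y
  simp only [Matrix.submatrix_apply, Matrix.add_apply, Matrix.sum_apply]
  congr 1
  symm
  refine Finset.sum_bij (fun i _ => k - i) (fun i hi => ?_) (fun i hi j hj hij => ?_)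
    (fun j hj => ?_) (fun i hi => ?_)
  · simpa using hr i (by simpa using hi)
  · have := hl i (by simpa using hi)
    have := hl j (by simpa using hj)
    omega
  · have hj : j ∈ reflect k l := by simpa using hj
    have := reflect_le j hj
    exact ⟨k - j, by simpa using (mem_reflect hl this).1 hj, by omega⟩
  · have hi : i ∈ l := by simpa using hi
    rw [← unitCol_submatrix (h1 i hi).1, ← unitCol_submatrix (h2 i hi).1,
      Nat.sub_sub_self (hl i hi)]
    simp only [Matrix.mul_apply, Matrix.submatrix_apply,
      Matrix.transpose_apply, id]

end Fiedler

namespace Fiedler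

/-! ### Counting wires -/

open Classical in
/-- The number of `w` with `c < w ≤ k` and `p w`. -/
noncomputable def countAbove (p : ℕ → Prop) (k c : ℕ) : ℕ :=
  ((Finset.Ioc c k).filter p).card

section Count

variable {p : ℕ → Prop} {k c d : ℕ}

theorem countAbove_self : countAbove p k k = 0 := by simp [countAbove]

theorem countAbove_anti (h : c ≤ d) : countAbove p k d ≤ countAbove p k c := by
  classical
  refine Finset.card_le_card fun x hx => ?_
  simp only [Finset.mem_filter, Finset.mem_Ioc] at hx ⊢
  exact ⟨⟨by omega, hx.1.2⟩, hx.2⟩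

theorem countAbove_lt (h : c < d) (hd : d ≤ k) (hp : p d) :
    countAbove p k d < countAbove p k c := by
  classical
  refine Finset.card_lt_card (Finset.ssubset_iff.2 ⟨d, by simp, fun x hx => ?_⟩)
  rcases Finset.mem_insert.1 hx with rfl | hx
  · simp [h, hd, hp]
  · simp only [Finset.mem_filter, Finset.mem_Ioc] at hx ⊢
    exact ⟨⟨by omega, hx.1.2⟩, hx.2⟩

theorem countAbove_inj (hc : c ≤ k) (hd : d ≤ k) (pc : p c) (pd : p d) :
    countAbove p k c = countAbove p k d ↔ c = d := by
  refine ⟨fun h => ?_, fun h => h ▸ rfl⟩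
  rcases lt_trichotomy c d with h' | h' | h'
  · exact absurd h (countAbove_lt h' hd pd).ne'
  · exact h'
  · exact absurd h (countAbove_lt h' hc pc).ne

theorem countAbove_eq_of_not (h : c ≤ d) (hp : ∀ w, c < w → w ≤ d → ¬ p w) :
    countAbove p k c = countAbove p k d := by
  unfold countAbove
  congr 1
  ext x
  simp only [Finset.mem_filter, Finset.mem_Ioc]
  constructor
  · rintro ⟨⟨h1, h2⟩, h3⟩
    exact ⟨⟨not_le.1 fun h' => hp x h1 h' h3, h2⟩, h3⟩
  · rintro ⟨⟨h1, h2⟩, h3⟩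
    exact ⟨⟨by omega, h2⟩, h3⟩

open Classical in
theorem countAbove_succ (h : c < k) :
    countAbove p k c = countAbove p k (c + 1) + if p (c + 1) then 1 else 0 := by
  unfold countAbove
  rw [← Finset.insert_Ioc_add_one_left_eq_Ioc h, Finset.filter_insert]
  split_ifs
  · rw [Finset.card_insert_of_notMem (by simp)]
  · simp

theorem countAbove_add_countAbove_not :
    countAbove p k c + countAbove (fun w => ¬ p w) k c = k - c := by
  classical
  unfold countAbove
  convert Finset.card_filter_add_card_filter_not (s := Finset.Ioc c k) p
  simp

end Count

/-! ### Body rows and body columns -/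

/-- The tuples of a proper generalized Fiedler pencil. -/
structure IsProperTuples (k : ℕ) (q z : List ℕ) : Prop where
  nodup_pos : q.Nodup
  nodup_neg : z.Nodup
  disjoint : ∀ i ∈ q, i ∉ z
  cover : ∀ i ≤ k, i ∈ q ∨ i ∈ z
  le_pos : ∀ i ∈ q, i ≤ k
  le_neg : ∀ i ∈ z, i ≤ k
  zero_mem : 0 ∈ q
  top_mem : k ∈ z

/-- The block-row `k - w` of the pencil with tuples `q`, `z` is a row of the body. The block-columns
of the body are obtained by reversing the two tuples. -/
def Body (q z : List ℕ) (w : ℕ) : Prop :=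
  (w - 1 ∈ q ∧ w ∈ z) ∨ LeftOf (w - 1) w q ∨ LeftOf w (w - 1) z

variable {k : ℕ} {q z : List ℕ}

namespace IsProperTuples

theorem reverse (h : IsProperTuples k q z) : IsProperTuples k q.reverse z.reverse where
  nodup_pos := List.nodup_reverse.2 h.nodup_pos
  nodup_neg := List.nodup_reverse.2 h.nodup_neg
  disjoint := by simpa using h.disjoint
  cover := by simpa using h.cover
  le_pos := by simpa using h.le_pos
  le_neg := by simpa using h.le_neg
  zero_mem := by simpa using h.zero_mem
  top_mem := by simpa using h.top_mem

theorem body_reverse (h : IsProperTuples k q z) {w : ℕ} : Body q.reverse z.reverse w ↔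
    (w - 1 ∈ q ∧ w ∈ z) ∨ LeftOf w (w - 1) q ∨ LeftOf (w - 1) w z := by
  rw [Body, leftOf_reverse h.nodup_pos, leftOf_reverse h.nodup_neg, List.mem_reverse,
    List.mem_reverse]

theorem not_mem_pos (h : IsProperTuples k q z) {w : ℕ} (hw : w ∈ z) : w ∉ q :=
  fun h' => h.disjoint w h' hw

theorem not_body_of_leftOf_pos (h : IsProperTuples k q z) {w : ℕ} (hw : LeftOf w (w - 1) q) :
    ¬ Body q z w := by
  rintro (h' | h' | h')
  · exact h.disjoint w hw.1 h'.2
  · exact hw.asymm h'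
  · exact h.disjoint w hw.1 h'.1

theorem not_body_of_leftOf_neg (h : IsProperTuples k q z) {w : ℕ} (hw : LeftOf (w - 1) w z) :
    ¬ Body q z w := by
  rintro (h' | h' | h')
  · exact h.disjoint _ h'.1 hw.1
  · exact h.disjoint w h'.2.1 hw.2.1
  · exact hw.asymm h'

theorem not_body_of_mem (h : IsProperTuples k q z) {w : ℕ} (h1 : w - 1 ∈ z) (h2 : w ∈ q) :
    ¬ Body q z w := by
  rintro (h' | h' | h')
  · exact h.disjoint _ h'.1 h1
  · exact h.disjoint _ h'.1 h1
  · exact h.disjoint w h2 h'.1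

open Classical in
-- If `w - 1` and `w` lie in the same tuple, exactly one of the row and the column of wire `w`
-- belongs to the body; if `w - 1 ∈ q` and `w ∈ z` both do; in the opposite case neither does. The
-- form is chosen to telescope in `w`.
theorem body_balance (h : IsProperTuples k q z) {w : ℕ} (hw : 1 ≤ w) (hwk : w ≤ k) :
    (if Body q z w then 1 else 0) + (if w ∈ q then 1 else 0) =
      (if ¬ Body q.reverse z.reverse w then 1 else 0) + (if w - 1 ∈ q then 1 else 0) := by
  rcases h.cover w hwk with hq | hz
  · rcases h.cover (w - 1) (by omega) with hq' | hz'
    · rcases leftOf_or hq hq' (by omega) with h' | h'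
      · have h2 : Body q.reverse z.reverse w := h.body_reverse.2 (Or.inr (Or.inl h'))
        simp [h.not_body_of_leftOf_pos h', h2, hq, hq']
      · have h2 : ¬ Body q.reverse z.reverse w :=
          h.reverse.not_body_of_leftOf_pos ((leftOf_reverse h.nodup_pos).2 h')
        have h1 : Body q z w := Or.inr (Or.inl h')
        simp [h1, h2, hq, hq']
    · have h2 : ¬ Body q.reverse z.reverse w :=
        h.reverse.not_body_of_mem (by simpa using hz') (by simpa using hq)
      simp [h.not_body_of_mem hz' hq, h2, hq, h.not_mem_pos hz']
  · rcases h.cover (w - 1) (by omega) with hq' | hz'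
    · have h1 : Body q z w := Or.inl ⟨hq', hz⟩
      have h2 : Body q.reverse z.reverse w := h.body_reverse.2 (Or.inl ⟨hq', hz⟩)
      simp [h1, h2, h.not_mem_pos hz, hq']
    · rcases leftOf_or hz hz' (by omega) with h' | h'
      · have h2 : ¬ Body q.reverse z.reverse w :=
          h.reverse.not_body_of_leftOf_neg ((leftOf_reverse h.nodup_neg).2 h')
        have h1 : Body q z w := Or.inr (Or.inr h')
        simp [h1, h2, h.not_mem_pos hz, h.not_mem_pos hz']
      · have h2 : Body q.reverse z.reverse w := h.body_reverse.2 (Or.inr (Or.inr h'))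
        simp [h.not_body_of_leftOf_neg h', h2, h.not_mem_pos hz, h.not_mem_pos hz']

open Classical in
-- Telescopes `body_balance` down from wire `k`, where `k ∈ z` kills the boundary term. At `c = 0`
-- the extra 1 makes one more body row than linking columns.
theorem countAbove_body (h : IsProperTuples k q z) {c : ℕ} (hc : c ≤ k) :
    countAbove (Body q z) k c =
      countAbove (fun w => ¬ Body q.reverse z.reverse w) k c + if c ∈ q then 1 else 0 := by
  induction hc using Nat.decreasingInduction with
  | self => simp [countAbove_self, h.not_mem_pos h.top_mem]
  | of_succ c hc ih =>
    have := h.body_balance (w := c + 1) (by omega) (by omega)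
    rw [countAbove_succ hc, countAbove_succ hc, ih]
    simp only [Nat.add_sub_cancel] at this
    split_ifs at this ⊢ <;> omega

open Classical in
theorem countAbove_body_add (h : IsProperTuples k q z) {c : ℕ} (hc : c ≤ k) :
    countAbove (Body q z) k c + countAbove (Body q.reverse z.reverse) k c =
      k - c + if c ∈ q then 1 else 0 := by
  have := h.countAbove_body hc
  have := countAbove_add_countAbove_not (p := Body q.reverse z.reverse) (k := k) (c := c)
  omega

/-- The climb from `c` skips only linking rows and stops at a body row, so it stops at the next body
row above `c`. -/
theorem firstAbove_body (h : IsProperTuples k q z) {c d : ℕ} (hc : c ∈ q)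
    (hd : FirstAbove q c d) :
    d ≤ k ∧ Body q z d ∧ countAbove (Body q z) k d + 1 = countAbove (Body q z) k c := by
  classical
  have hp := hd.pred_mem hc
  have hlt := hd.lt
  have hk : d - 1 ≠ k := fun h' => h.not_mem_pos h.top_mem (h' ▸ hp)
  have hdk : d ≤ k := by have := h.le_pos _ hp; omega
  have hb : Body q z d := by
    rcases h.cover d hdk with h' | h'
    · exact Or.inr (Or.inl ((leftOf_or h' hp (by omega)).resolve_left hd.not_leftOf))
    · exact Or.inl ⟨hp, h'⟩
  refine ⟨hdk, hb, ?_⟩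
  rw [countAbove_eq_of_not (c := c) (d := d - 1) (by omega) fun w h1 h2 =>
    h.not_body_of_leftOf_pos (hd.leftOf w h1 (by omega)), countAbove_succ (c := d - 1) (by omega),
    Nat.sub_add_cancel (by omega), if_pos hb]

/-- All wires crossed in the descent from `c` to `d` are linking rows, so the count does not change.
-/
theorem firstBelow_body (h : IsProperTuples k q z) {c d : ℕ} (hc : c ∈ z)
    (hd : FirstBelow z c d) :
    1 ≤ d ∧ Body q z d ∧ countAbove (Body q z) k d = countAbove (Body q z) k c := by
  have hle := hd.le
  have hdz : d ∈ z := by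
    by_cases hdc : d = c
    · rwa [hdc]
    · simpa using (hd.leftOf (d + 1) (by omega) (by omega)).1
  have h0 : 1 ≤ d := Nat.one_le_iff_ne_zero.2 fun h' => h.disjoint 0 h.zero_mem (h' ▸ hdz)
  refine ⟨h0, ?_, countAbove_eq_of_not hle fun w h1 h2 =>
    h.not_body_of_leftOf_neg (hd.leftOf w h1 h2)⟩
  rcases h.cover (d - 1) (by have := h.le_neg d hdz; omega) with h' | h'
  · exact Or.inl ⟨h', hdz⟩
  · exact Or.inr (Or.inr ((leftOf_or h' hdz (by omega)).resolve_left hd.not_leftOf))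

/-! ### Passage of linking and body columns through a proper pencil -/

variable {F : Type*} [Field F] {n : ℕ}

/-- Source of the entries -1 of the linking block: the body row reached has the same rank as the
linking column. -/
theorem exists_posProd_linking (h : IsProperTuples k q z) (A : ℕ → Matrix (Fin n) (Fin n) F)
    {c : ℕ} (hc : 1 ≤ c) (hck : c ≤ k) (hl : ¬ Body q.reverse z.reverse c) :
    ∃ ρ ≤ k, Body q z ρ ∧ countAbove (Body q z) k ρ =
        countAbove (fun w => ¬ Body q.reverse z.reverse w) k c ∧
      posProd k A q * unitCol F k n c = unitCol F k n ρ := by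
  classical
  have hcount := h.countAbove_body hck
  rw [h.body_reverse, not_or, not_or] at hl
  rcases h.cover c hck with hq | hz
  · obtain ⟨d, hd, hd'⟩ := exists_posProd_mul_unitCol (k := k) A h.nodup_pos hq hc hl.2.1
    obtain ⟨h1, h2, h3⟩ := h.firstAbove_body hq hd
    rw [if_pos hq] at hcount
    exact ⟨d, h1, h2, by omega, hd'⟩
  · have hq := h.not_mem_pos hz
    have hq' : c - 1 ∉ q := fun h' => hl.1 ⟨h', hz⟩
    have hz' := (h.cover (c - 1) (by omega)).resolve_left hq'
    rw [if_neg hq] at hcount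
    exact ⟨c, hck, Or.inr (Or.inr ((leftOf_or hz' hz (by omega)).resolve_left hl.2.2)), hcount,
      posProd_mul_unitCol_of_notMem A hq hq' hc⟩

/-- Source of the entries λ of the linking block: the rank of the row reached is one larger than
that of the column. -/
theorem exists_negProd_linking (h : IsProperTuples k q z) (A : ℕ → Matrix (Fin n) (Fin n) F)
    {c : ℕ} (hc : 1 ≤ c) (hck : c ≤ k) (hl : ¬ Body q.reverse z.reverse c) :
    ∃ ρ ≤ k, Body q z ρ ∧ countAbove (Body q z) k ρ =
        countAbove (fun w => ¬ Body q.reverse z.reverse w) k c + 1 ∧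
      negProd k A z * unitCol F k n c = unitCol F k n ρ := by
  classical
  have hl' := hl
  rw [h.body_reverse, not_or, not_or] at hl
  rcases h.cover (c - 1) (by omega) with hq' | hz'
  · have hz : c ∉ z := fun h' => hl.1 ⟨hq', h'⟩
    have hq := (h.cover c hck).resolve_right hz
    have hcount := h.countAbove_body hck
    rw [if_pos hq] at hcount
    exact ⟨c, hck, Or.inr (Or.inl ((leftOf_or hq hq' (by omega)).resolve_left hl.2.1)), hcount,
      negProd_mul_unitCol_of_notMem A h.le_neg hz (h.disjoint _ hq') hc hck⟩
  · obtain ⟨d, hd, hd'⟩ := exists_negProd_mul_unitCol A h.le_neg h.nodup_neg hz' (by omega)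
      (by rw [Nat.sub_add_cancel hc]; exact hl.2.2)
    obtain ⟨h1, h2, h3⟩ := h.firstBelow_body hz' hd
    rw [Nat.sub_add_cancel hc] at hd'
    have hcount := h.countAbove_body (c := c - 1) (by omega)
    have h4 := countAbove_succ (p := fun w => ¬ Body q.reverse z.reverse w) (c := c - 1) (k := k)
      (by omega)
    rw [Nat.sub_add_cancel hc, if_pos hl'] at h4
    rw [if_neg (h.not_mem_pos hz')] at hcount
    have := hd.le
    exact ⟨d, by omega, h2, by omega, hd'⟩

/-- Without coefficients a body column reaches no body row. Inside the body, therefore, only the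
coefficient terms of the expansion survive. -/
theorem exists_posProd_zero_mul_unitCol (h : IsProperTuples k q z) {c : ℕ} (hc : 1 ≤ c)
    (hck : c ≤ k) (hb : Body q.reverse z.reverse c) :
    ∃ d, ¬ (1 ≤ d ∧ Body q z d) ∧
      posProd k (0 : ℕ → Matrix (Fin n) (Fin n) F) q *
        unitCol F k n c = unitCol F k n d := by
  rw [h.body_reverse] at hb
  by_cases hq' : c - 1 ∈ q
  · have hlo : ¬ LeftOf (c - 1) c q := by
      intro h'
      rcases hb with hb | hb | hb
      · exact h.disjoint c h'.2.1 hb.2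
      · exact hb.asymm h'
      · exact h.disjoint _ hq' hb.1
    -- With zero coefficient the cores of `M_i` and `M_{-i}` are the same matrix, so the descent
    -- along negative indices applies to the tuple `q`.
    obtain ⟨d, hd, hd'⟩ := exists_negProd_mul_unitCol (0 : ℕ → Matrix (Fin n) (Fin n) F)
      h.le_pos h.nodup_pos hq' (by omega) (by rwa [Nat.sub_add_cancel hc])
    rw [Nat.sub_add_cancel hc] at hd'
    refine ⟨d, fun h' => ?_, hd'⟩
    have hle := hd.le
    have hdq : d ∈ q := by
      by_cases hdc : d = c - 1
      · rwa [hdc]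
      · simpa using (hd.leftOf (d + 1) (by omega) (by omega)).1
    rcases h'.2 with hb' | hb' | hb'
    · exact h.disjoint d hdq hb'.2
    · exact hd.not_leftOf hb'
    · exact h.disjoint d hdq hb'.1
  · have hzz : LeftOf (c - 1) c z := by
      rcases hb with hb | hb | hb
      · exact absurd hb.1 hq'
      · exact absurd hb.2.1 hq'
      · exact hb
    exact ⟨c, fun h' => h.not_body_of_leftOf_neg hzz h'.2,
      posProd_mul_unitCol_of_notMem 0 (h.not_mem_pos hzz.2.1) hq' hc⟩

theorem exists_negProd_zero_mul_unitCol (h : IsProperTuples k q z) {c : ℕ} (hc : 1 ≤ c)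
    (hck : c ≤ k) (hb : Body q.reverse z.reverse c) :
    ∃ d, ¬ (d ≤ k ∧ Body q z d) ∧
      negProd k (0 : ℕ → Matrix (Fin n) (Fin n) F) z *
        unitCol F k n c = unitCol F k n d := by
  rw [h.body_reverse] at hb
  by_cases hz : c ∈ z
  · have hlo : ¬ LeftOf c (c - 1) z := by
      intro h'
      rcases hb with hb | hb | hb
      · exact h.disjoint _ hb.1 h'.2.1
      · exact h.disjoint c hb.1 hz
      · exact hb.asymm h'
    -- Conversely, zero coefficients let the climb along positive indices apply to `z`.
    obtain ⟨d, hd, hd'⟩ := exists_posProd_mul_unitCol (k := k)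
      (0 : ℕ → Matrix (Fin n) (Fin n) F) h.nodup_neg hz hc hlo
    refine ⟨d, fun h' => ?_, hd'⟩
    have hp := hd.pred_mem hz
    rcases h'.2 with hb' | hb' | hb'
    · exact h.disjoint _ hb'.1 hp
    · exact h.disjoint _ hb'.1 hp
    · exact hd.not_leftOf hb'
  · have hqq : LeftOf c (c - 1) q := by
      rcases hb with hb | hb | hb
      · exact absurd hb.2 hz
      · exact hb
      · exact absurd hb.2.1 hz
    exact ⟨c, fun h' => h.not_body_of_leftOf_pos hqq h'.2,
      negProd_mul_unitCol_of_notMem 0 h.le_neg hz (h.disjoint _ hqq.2.1) hc hck⟩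

end IsProperTuples

end Fiedler

namespace Fiedler

/-! ### The entries of a proper pencil -/

variable {F : Type*} [Field F] {k n : ℕ} {q z : List ℕ}

open Classical in
-- Describes a unit column by rank instead of wire, since positions in the permuted pencil are
-- ranks.
theorem unitCol_apply_eq_ite {p : ℕ → Prop} {ρ m : ℕ} (hρ : ρ ≤ k) (hp : p ρ)
    (hm : countAbove p k ρ = m) (r : Fin k) (α β : Fin n) :
    unitCol F k n ρ (r, α) β =
      if p (k - r) ∧ countAbove p k (k - r) = m ∧ α = β then 1 else 0 := by
  have hr := r.2
  unfold unitCol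
  refine if_congr ?_ rfl rfl
  rw [← and_assoc]
  refine and_congr_left fun _ => ?_
  constructor
  · intro h
    have : k - (r : ℕ) = ρ := by simp only at h; omega
    rw [this]
    exact ⟨hp, hm⟩
  · rintro ⟨h1, h2⟩
    have := (countAbove_inj (by omega) hρ h1 hp).1 (h2.trans hm.symm)
    simp only
    omega

namespace IsProperTuples

open Classical in
theorem posProd_apply_of_linking (h : IsProperTuples k q z) (A : ℕ → Matrix (Fin n) (Fin n) F)
    (r s : Fin k) (α β : Fin n) (hs : ¬ Body q.reverse z.reverse (k - s)) :
    posProd k A q (r, α) (s, β) = if Body q z (k - r) ∧ countAbove (Body q z) k (k - r) =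
      countAbove (fun w => ¬ Body q.reverse z.reverse w) k (k - s) ∧ α = β then 1 else 0 := by
  have hs' := s.2
  obtain ⟨ρ, h1, h2, h3, h4⟩ := h.exists_posProd_linking A (c := k - s) (by omega) (by omega) hs
  rw [← mul_unitCol_apply (posProd k A q) (w := k - s) s (by omega), h4,
    unitCol_apply_eq_ite h1 h2 h3]

open Classical in
theorem negProd_apply_of_linking (h : IsProperTuples k q z) (A : ℕ → Matrix (Fin n) (Fin n) F)
    (r s : Fin k) (α β : Fin n) (hs : ¬ Body q.reverse z.reverse (k - s)) :
    negProd k A z (r, α) (s, β) = if Body q z (k - r) ∧ countAbove (Body q z) k (k - r) =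
      countAbove (fun w => ¬ Body q.reverse z.reverse w) k (k - s) + 1 ∧ α = β then 1 else 0 := by
  have hs' := s.2
  obtain ⟨ρ, h1, h2, h3, h4⟩ := h.exists_negProd_linking A (c := k - s) (by omega) (by omega) hs
  rw [← mul_unitCol_apply (negProd k A z) (w := k - s) s (by omega), h4,
    unitCol_apply_eq_ite h1 h2 h3]

open Classical in
theorem posProd_apply_of_body (h : IsProperTuples k q z) (A : ℕ → Matrix (Fin n) (Fin n) F)
    (r s : Fin k) (α β : Fin n) (hr : Body q z (k - r))
    (hs : Body q.reverse z.reverse (k - s)) :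
    posProd k A q (r, α) (s, β) = ∑ i ∈ q.toFinset,
      if countAbove (Body q z) k (k - r) + 1 = countAbove (Body q z) k i ∧
        countAbove (Body q.reverse z.reverse) k (k - s) + 1 =
          countAbove (Body q.reverse z.reverse) k i then A i α β else 0 := by
  have hr' := r.2
  have hs' := s.2
  obtain ⟨d, hd, hd'⟩ := h.exists_posProd_zero_mul_unitCol (F := F) (n := n) (c := k - s)
    (by omega) (by omega) hs
  obtain ⟨ρ, γ, hργ, hA⟩ := exists_posProd_eq_add_sum (k := k) A h.nodup_pos
  have h0 : posProd k (0 : ℕ → Matrix (Fin n) (Fin n) F) q (r, α) (s, β) = 0 := by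
    rw [← mul_unitCol_apply (posProd k (0 : ℕ → Matrix (Fin n) (Fin n) F) q)
      (w := k - s) s (by omega), hd']
    refine if_neg fun h' => hd ?_
    simp only at h'
    obtain rfl : d = k - r := by omega
    exact ⟨by omega, hr⟩
  rw [hA, Matrix.add_apply, h0, zero_add, Matrix.sum_apply]
  refine Finset.sum_congr rfl fun i hi => ?_
  have hi : i ∈ q := by simpa using hi
  rw [unitCol_mul_mul_unitCol_apply]
  obtain ⟨h1, h2, h3⟩ := h.firstAbove_body hi (hργ i hi).1
  obtain ⟨h4, h5, h6⟩ := h.reverse.firstAbove_body (by simpa using hi) (hργ i hi).2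
  refine if_congr ?_ rfl rfl
  rw [← h3, ← h6, Nat.add_right_cancel_iff, Nat.add_right_cancel_iff,
    countAbove_inj (by omega) h1 hr h2, countAbove_inj (by omega) h4 hs h5]
  simp only
  omega

open Classical in
theorem negProd_apply_of_body (h : IsProperTuples k q z) (A : ℕ → Matrix (Fin n) (Fin n) F)
    (r s : Fin k) (α β : Fin n) (hr : Body q z (k - r))
    (hs : Body q.reverse z.reverse (k - s)) :
    negProd k A z (r, α) (s, β) = ∑ i ∈ z.toFinset,
      if countAbove (Body q z) k (k - r) = countAbove (Body q z) k i ∧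
        countAbove (Body q.reverse z.reverse) k (k - s) =
          countAbove (Body q.reverse z.reverse) k i then A i α β else 0 := by
  have hr' := r.2
  have hs' := s.2
  obtain ⟨d, hd, hd'⟩ := h.exists_negProd_zero_mul_unitCol (F := F) (n := n) (c := k - s)
    (by omega) (by omega) hs
  obtain ⟨ρ, γ, hργ, hA⟩ := exists_negProd_eq_add_sum (k := k) A h.le_neg h.nodup_neg
  have h0 : negProd k (0 : ℕ → Matrix (Fin n) (Fin n) F) z (r, α) (s, β) = 0 := by
    rw [← mul_unitCol_apply (negProd k (0 : ℕ → Matrix (Fin n) (Fin n) F) z)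
      (w := k - s) s (by omega), hd']
    refine if_neg fun h' => hd ?_
    simp only at h'
    obtain rfl : d = k - r := by omega
    exact ⟨by omega, hr⟩
  rw [hA, Matrix.add_apply, h0, zero_add, Matrix.sum_apply]
  refine Finset.sum_congr rfl fun i hi => ?_
  have hi : i ∈ z := by simpa using hi
  have hik := h.le_neg i hi
  rw [unitCol_mul_mul_unitCol_apply]
  obtain ⟨h1, h2, h3⟩ := h.firstBelow_body hi (hργ i hi).1
  obtain ⟨h4, h5, h6⟩ := h.reverse.firstBelow_body (by simpa using hi) (hργ i hi).2
  have h7 := (hργ i hi).1.le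
  have h8 := (hργ i hi).2.le
  refine if_congr ?_ rfl rfl
  rw [← h3, ← h6, countAbove_inj (by omega) (by omega) hr h2,
    countAbove_inj (by omega) (by omega) hs h5]
  simp only
  omega

/-- The value at block `(r, s)` of a linking block-column `s`. -/
theorem pencil_apply_of_linking (h : IsProperTuples k q z)
    (A B : ℕ → Matrix (Fin n) (Fin n) F) (r s : Fin k) (α β : Fin n)
    (hs : ¬ Body q.reverse z.reverse (k - s)) :
    (¬ Body q z (k - r) → (X : F[X]) * C (negProd k A z (r, α) (s, β)) -
      C (posProd k B q (r, α) (s, β)) = 0) ∧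
    ∀ b (i : Fin (b + 1)) (j : Fin b), Body q z (k - r) →
      (i : ℕ) = countAbove (Body q z) k (k - r) →
      (j : ℕ) = countAbove (fun w => ¬ Body q.reverse z.reverse w) k (k - s) →
      (X : F[X]) * C (negProd k A z (r, α) (s, β)) - C (posProd k B q (r, α) (s, β)) =
        Lpencil F b j i * (1 : Matrix (Fin n) (Fin n) F[X]) α β := by
  classical
  rw [h.negProd_apply_of_linking A r s α β hs, h.posProd_apply_of_linking B r s α β hs]
  refine ⟨fun hr => by simp [hr], fun b i j hr hi hj => ?_⟩
  rw [← hi, ← hj]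
  by_cases hαβ : α = β
  · subst hαβ
    have e1 : (i : ℕ) = j ↔ i = j.castSucc := by rw [Fin.ext_iff]; simp
    have e2 : (i : ℕ) = j + 1 ↔ i = j.succ := by rw [Fin.ext_iff]; simp
    simp only [hr, and_true, true_and, e1, e2, Lpencil, Matrix.one_apply_eq, mul_one]
    have h3 : j.castSucc ≠ j.succ := by rw [Ne, Fin.ext_iff]; simp
    by_cases h1 : i = j.castSucc
    · simp [h1, h3]
    · by_cases h2 : i = j.succ
      · simp [h2, h3.symm]
      · simp [h1, h2]
  · simp [hαβ]

end IsProperTuples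

/-! ### Permuting the blocks -/

theorem blockPerm_mul_mul_blockPerm_apply {R : Type*} [Semiring R] (l r : Equiv.Perm (Fin k))
    (H : Matrix (Fin k × Fin n) (Fin k × Fin n) R) (x y : Fin k × Fin n) :
    (blockTranspose (blockPerm n l) * H * blockPerm n r :
      Matrix (Fin k × Fin n) (Fin k × Fin n) R) x y = H (l x.1, x.2) (r y.1, y.2) := by
  have h1 : ∀ y, (blockTranspose (blockPerm n l) * H : Matrix _ _ R) x y = H (l x.1, x.2) y := by
    intro y
    rw [Matrix.mul_apply, Finset.sum_eq_single (l x.1, x.2)]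
    · simp [blockTranspose, blockPerm, ofBlocks, blk]
    · intro w _ hw
      simp only [blockTranspose, blockPerm, ofBlocks, blk]
      by_cases hwl : w.1 = l x.1
      · have : x.2 ≠ w.2 := fun h' => hw (Prod.ext hwl h'.symm)
        simp [hwl, this]
      · simp [hwl]
    · simp
  rw [Matrix.mul_apply, Finset.sum_eq_single (r y.1, y.2)]
  · rw [h1]
    simp [blockPerm, ofBlocks]
  · intro w _ hw
    simp only [blockPerm, ofBlocks]
    by_cases hwl : w.1 = r y.1
    · have : w.2 ≠ y.2 := fun h' => hw (Prod.ext hwl h')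
      simp [hwl, this]
    · simp [hwl]
  · simp

theorem split_sumMap {a b : ℕ} (h : a + b = k) (φ : Fin k ≃ Fin a ⊕ Fin b) (r : Fin k)
    (α : Fin n) :
    (split n h).symm (φ.trans (finSumFinEquiv.trans (finCongr h)) r, α) =
      Sum.map (fun i => (i, α)) (fun i => (i, α)) (φ r) := by
  rw [Equiv.symm_apply_eq]
  rcases hφ : φ r with i | i <;> simp [split, hφ]

/-- The elements satisfying `p` are listed before the others, both in order. -/
theorem exists_equiv_countAbove (p : ℕ → Prop) {m m' : ℕ} (hm : countAbove p k 0 = m)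
    (hm' : countAbove (fun w => ¬ p w) k 0 = m') :
    ∃ φ : Fin k ≃ Fin m ⊕ Fin m', ∀ r : Fin k,
      (∀ i, φ r = Sum.inl i → p (k - r) ∧ (i : ℕ) = countAbove p k (k - r)) ∧
      (∀ i, φ r = Sum.inr i →
        ¬ p (k - r) ∧ (i : ℕ) = countAbove (fun w => ¬ p w) k (k - r)) := by
  classical
  have hlt : ∀ (p' : ℕ → Prop) (r : Fin k), p' (k - r) →
      countAbove p' k (k - r) < countAbove p' k 0 := fun p' r h =>
    countAbove_lt (by have := r.2; omega) (by omega) h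
  let f : Fin k → Fin m ⊕ Fin m' := fun r =>
    if h : p (k - r) then Sum.inl ⟨countAbove p k (k - r), hm ▸ hlt p r h⟩
    else Sum.inr ⟨countAbove (fun w => ¬ p w) k (k - r), hm' ▸ hlt (fun w => ¬ p w) r h⟩
  have hf : Function.Injective f := by
    intro r s hrs
    have hr := r.2
    have hs := s.2
    simp only [f] at hrs
    split_ifs at hrs with h1 h2 h2
    · have := (countAbove_inj (k := k) (c := k - r) (d := k - s) (by omega)
        (by omega) h1 h2).1 (by simpa using hrs)
      exact Fin.ext (by omega)
    · have := (countAbove_inj (p := fun w => ¬ p w) (k := k) (c := k - r) (d := k - s) (by omega)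
        (by omega) h1 h2).1 (by simpa using hrs)
      exact Fin.ext (by omega)
  have hcard : Fintype.card (Fin k) = Fintype.card (Fin m ⊕ Fin m') := by
    have := countAbove_add_countAbove_not (p := p) (k := k) (c := 0)
    simp only [Fintype.card_fin, Fintype.card_sum]
    omega
  refine ⟨Equiv.ofBijective f ((Fintype.bijective_iff_injective_and_card f).2 ⟨hf, hcard⟩),
    fun r => ⟨fun i hi => ?_, fun i hi => ?_⟩⟩
  · rw [Equiv.ofBijective_apply] at hi
    simp only [f] at hi
    split_ifs at hi with h1
    obtain rfl := Sum.inl.inj hi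
    exact ⟨h1, rfl⟩
  · rw [Equiv.ofBijective_apply] at hi
    simp only [f] at hi
    split_ifs at hi with h1
    obtain rfl := Sum.inr.inj hi
    exact ⟨h1, rfl⟩

theorem sum_ite_antidiagonal {G : Type*} [AddCommMonoid G] {a b i₀ j₀ : ℕ} (hi : i₀ < a)
    (hj : j₀ < b) (c : ℕ → ℕ → Prop) [∀ i j, Decidable (c i j)] (g : G) :
    (∑ i : Fin a, ∑ j : Fin b, if c i j then (if (i : ℕ) = i₀ ∧ (j : ℕ) = j₀ then g else 0) else 0)
      = if c i₀ j₀ then g else 0 := by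
  rw [Finset.sum_eq_single ⟨i₀, hi⟩, Finset.sum_eq_single ⟨j₀, hj⟩]
  · simp
  · intro j _ hj'
    have : (j : ℕ) ≠ j₀ := fun h => hj' (Fin.ext h)
    simp [this]
  · simp
  · intro i _ hi'
    have : (i : ℕ) ≠ i₀ := fun h => hi' (Fin.ext h)
    simp [this]
  · simp

/-- Each `A t` occupies one in-range position, so a sum over positions becomes a sum over
coefficients. -/
theorem sum_ite_sum_ite {G : Type*} [AddCommMonoid G] {a b : ℕ} (S : Finset ℕ) {I J : ℕ → ℕ}
    (hI : ∀ t ∈ S, I t < a) (hJ : ∀ t ∈ S, J t < b) (c : ℕ → ℕ → Prop)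
    [∀ i j, Decidable (c i j)] (A : ℕ → G) :
    (∑ i : Fin a, ∑ j : Fin b, if c i j then
      (∑ t ∈ S, if (i : ℕ) = I t ∧ (j : ℕ) = J t then A t else 0) else 0) =
      ∑ t ∈ S, if c (I t) (J t) then A t else 0 := by
  have h1 : ∀ i j : ℕ, (if c i j then (∑ t ∈ S, if i = I t ∧ j = J t then A t else 0) else 0) =
      ∑ t ∈ S, if c i j then (if i = I t ∧ j = J t then A t else 0) else 0 := by
    intro i j
    split_ifs
    · rfl
    · simp
  simp only [h1]
  rw [Finset.sum_congr rfl fun i _ => Finset.sum_comm, Finset.sum_comm]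
  exact Finset.sum_congr rfl fun t ht => sum_ite_antidiagonal (hI t ht) (hJ t ht) c (A t)

end Fiedler

namespace Fiedler

/-! ### The antidiagonal sum condition -/

variable {F : Type*} [Field F] {k n : ℕ} {q z : List ℕ}

namespace IsProperTuples

theorem countAbove_zero_eq (h : IsProperTuples k q z) {a b : ℕ}
    (ha : countAbove (fun w => ¬ Body q z w) k 0 = a)
    (hb : countAbove (fun w => ¬ Body q.reverse z.reverse w) k 0 = b) :
    countAbove (Body q z) k 0 = b + 1 ∧ countAbove (Body q.reverse z.reverse) k 0 = a + 1 := by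
  classical
  have h1 := h.countAbove_body (Nat.zero_le k)
  have h2 := h.reverse.countAbove_body (Nat.zero_le k)
  simp only [List.reverse_reverse, List.mem_reverse, h.zero_mem, if_true] at h1 h2
  omega

theorem countAbove_body_pos (h : IsProperTuples k q z) {t : ℕ} (ht : t ∈ q) :
    1 ≤ countAbove (Body q z) k t ∧ countAbove (Body q z) k t ≤ countAbove (Body q z) k 0 := by
  have h1 := h.countAbove_body (h.le_pos t ht)
  rw [if_pos ht] at h1
  exact ⟨by omega, countAbove_anti (Nat.zero_le t)⟩

theorem countAbove_body_neg (h : IsProperTuples k q z) {t : ℕ} (ht : t ∈ z) :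
    countAbove (Body q z) k t < countAbove (Body q z) k 0 := by
  have h1 := h.countAbove_body (h.le_neg t ht)
  have h2 := h.countAbove_body (Nat.zero_le k)
  have h3 := countAbove_anti (p := fun w => ¬ Body q.reverse z.reverse w) (k := k) (Nat.zero_le t)
  rw [if_neg (h.not_mem_pos ht)] at h1
  rw [if_pos h.zero_mem] at h2
  omega

theorem sum_antidiagonal_eq {G : Type*} [AddCommMonoid G] (h : IsProperTuples k q z) {a b : ℕ}
    (ha : countAbove (Body q.reverse z.reverse) k 0 = a)
    (hb : countAbove (Body q z) k 0 = b) (A : ℕ → G) {s : ℕ} (hs : s ≤ k) :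
    (∑ i : Fin b, ∑ j : Fin a, if ((i : ℕ) + 1) + ((j : ℕ) + 1) + s = k + 2 then
        (∑ t ∈ z.toFinset, if (i : ℕ) = countAbove (Body q z) k t ∧
          (j : ℕ) = countAbove (Body q.reverse z.reverse) k t then A t else 0) else 0) +
      (∑ i : Fin b, ∑ j : Fin a, if ((i : ℕ) + 1) + ((j : ℕ) + 1) + s = k + 1 then
        (∑ t ∈ q.toFinset, if (i : ℕ) = countAbove (Body q z) k t - 1 ∧
          (j : ℕ) = countAbove (Body q.reverse z.reverse) k t - 1 then A t else 0) else 0) =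
      A s := by
  have hz : ∀ t ∈ z.toFinset, t ∈ z := fun t ht => List.mem_toFinset.1 ht
  have hq : ∀ t ∈ q.toFinset, t ∈ q := fun t ht => List.mem_toFinset.1 ht
  have hrq : ∀ t ∈ q, t ∈ q.reverse := fun t ht => List.mem_reverse.2 ht
  have hrz : ∀ t ∈ z, t ∈ z.reverse := fun t ht => List.mem_reverse.2 ht
  rw [sum_ite_sum_ite _ (fun t ht => hb ▸ h.countAbove_body_neg (hz t ht))
      (fun t ht => ha ▸ h.reverse.countAbove_body_neg (hrz t (hz t ht)))
      (fun i j => (i + 1) + (j + 1) + s = k + 2),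
    sum_ite_sum_ite _
      (fun t ht => by have := h.countAbove_body_pos (hq t ht); omega)
      (fun t ht => by have := h.reverse.countAbove_body_pos (hrq t (hq t ht)); omega)
      (fun i j => (i + 1) + (j + 1) + s = k + 1)]
  have e1 : ∀ t ∈ z.toFinset, (if (countAbove (Body q z) k t + 1) +
      (countAbove (Body q.reverse z.reverse) k t + 1) + s = k + 2 then A t else 0) =
      if t = s then A t else 0 := by
    intro t ht
    have h1 := h.countAbove_body_add (h.le_neg t (hz t ht))
    have h2 := h.le_neg t (hz t ht)
    rw [if_neg (h.not_mem_pos (hz t ht))] at h1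
    exact if_congr (by omega) rfl rfl
  have e2 : ∀ t ∈ q.toFinset, (if (countAbove (Body q z) k t - 1 + 1) +
      (countAbove (Body q.reverse z.reverse) k t - 1 + 1) + s = k + 1 then A t else 0) =
      if t = s then A t else 0 := by
    intro t ht
    have h1 := h.countAbove_body_add (h.le_pos t (hq t ht))
    have h2 := h.le_pos t (hq t ht)
    have h3 := h.countAbove_body_pos (hq t ht)
    have h4 := h.reverse.countAbove_body_pos (hrq t (hq t ht))
    rw [if_pos (hq t ht)] at h1
    exact if_congr (by omega) rfl rfl
  rw [Finset.sum_congr rfl e1, Finset.sum_congr rfl e2, Finset.sum_ite_eq', Finset.sum_ite_eq']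
  simp only [List.mem_toFinset]
  rcases h.cover s hs with h' | h'
  · simp [h', h.disjoint s h']
  · simp [h', h.not_mem_pos h']

/-- A proper pencil is block-permutationally equivalent to a block Kronecker pencil. -/
theorem exists_blockKronecker (h : IsProperTuples k q z) (P : Matrix (Fin n) (Fin n) F[X])
    (H : Matrix (Fin k × Fin n) (Fin k × Fin n) F[X])
    (hH : H = (X : F[X]) • constMat (negProd k (coeffMat P) z) -
      constMat (posProd k (fun i => -coeffMat P i) q)) :
    ∃ (l r : Equiv.Perm (Fin k)) (a b : ℕ)
      (M : Matrix (Fin (b + 1) × Fin n) (Fin (a + 1) × Fin n) F[X]),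
      IsBlockKroneckerPencil a b
        (blockTranspose (blockPerm n l) * H * blockPerm n r) M ∧ ASCondition M P := by
  classical
  obtain ⟨a, ha⟩ : ∃ a, countAbove (fun w => ¬ Body q z w) k 0 = a := ⟨_, rfl⟩
  obtain ⟨b, hb⟩ : ∃ b, countAbove (fun w => ¬ Body q.reverse z.reverse w) k 0 = b := ⟨_, rfl⟩
  obtain ⟨hb', ha'⟩ := h.countAbove_zero_eq ha hb
  obtain ⟨φ, hφ⟩ := exists_equiv_countAbove (Body q z) hb' ha
  obtain ⟨ψ, hψ⟩ := exists_equiv_countAbove (Body q.reverse z.reverse) ha' hb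
  have hr : b + 1 + a = k := by simpa using (Fintype.card_congr φ).symm
  have hc : a + 1 + b = k := by omega
  have hent : ∀ x y, H x y = X * C (negProd k (coeffMat P) z x y) -
      C (posProd k (fun i => -coeffMat P i) q x y) := by
    intro x y
    simp [hH, constMat]
  let M : Matrix (Fin (b + 1) × Fin n) (Fin (a + 1) × Fin n) F[X] := fun x y =>
    H (φ.symm (Sum.inl x.1), x.2) (ψ.symm (Sum.inl y.1), y.2)
  have hM : ∀ i α j β, M (i, α) (j, β) =
      H (φ.symm (Sum.inl i), α) (ψ.symm (Sum.inl j), β) := fun _ _ _ _ => rfl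
  -- Inverses appear because `blockPerm` takes the map from new positions to old block indices.
  refine ⟨(φ.trans (finSumFinEquiv.trans (finCongr hr))).symm,
    (ψ.trans (finSumFinEquiv.trans (finCongr hc))).symm, a, b, M, ⟨?_, hr, hc, ?_⟩, ?_⟩
  · rintro ⟨i, α⟩ ⟨j, β⟩
    rw [hM, hent]
    compute_degree
  · ext1 ⟨i, α⟩ ⟨j, β⟩
    rw [blockPerm_mul_mul_blockPerm_apply]
    obtain ⟨r, rfl⟩ := (φ.trans (finSumFinEquiv.trans (finCongr hr))).surjective i
    obtain ⟨s, rfl⟩ := (ψ.trans (finSumFinEquiv.trans (finCongr hc))).surjective j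
    rw [Matrix.reindex_apply, Matrix.submatrix_apply, split_sumMap, split_sumMap,
      Equiv.symm_apply_apply, Equiv.symm_apply_apply]
    have hcol := h.pencil_apply_of_linking (coeffMat P) (fun i => -coeffMat P i) r s α β
    -- Linking rows are linking columns of the transposed pencil, whose tuples are reversed.
    have hrow := h.reverse.pencil_apply_of_linking (fun i => (coeffMat P i)ᵀ)
      (fun i => (-coeffMat P i)ᵀ) s r β α
    rw [← negProd_transpose _ h.le_neg, ← posProd_transpose] at hrow
    simp only [List.reverse_reverse, Matrix.transpose_apply] at hrow
    rw [← hent] at hcol hrow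
    rcases hφr : φ r with i | i <;> rcases hψs : ψ s with j | j
    · have h1 : φ.symm (Sum.inl i) = r := by rw [← hφr, φ.symm_apply_apply]
      have h2 : ψ.symm (Sum.inl j) = s := by rw [← hψs, ψ.symm_apply_apply]
      rw [← h1, ← h2, ← hM]
      simp [blockKronecker]
    · obtain ⟨h1, h2⟩ := (hφ r).1 i hφr
      obtain ⟨h3, h4⟩ := (hψ s).2 j hψs
      rw [(hcol h3).2 b i j h1 h2 h4]
      simp [blockKronecker]
    · obtain ⟨h1, h2⟩ := (hφ r).2 i hφr
      obtain ⟨h3, h4⟩ := (hψ s).1 j hψs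
      rw [(hrow h1).2 a j i h3 h4 h2]
      simp [blockKronecker, Matrix.one_apply, eq_comm]
    · obtain ⟨h1, h2⟩ := (hφ r).2 i hφr
      obtain ⟨h3, h4⟩ := (hψ s).2 j hψs
      rw [(hcol h3).1 h1]
      simp [blockKronecker]
  · intro s hs
    have hrow := fun i => (hφ (φ.symm (Sum.inl i))).1 i (by simp)
    have hcol := fun j => (hψ (ψ.symm (Sum.inl j))).1 j (by simp)
    have h1 : ∀ i j, blk (coeffMat M 1) i j = ∑ t ∈ z.toFinset,
        if (i : ℕ) = countAbove (Body q z) k t ∧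
          (j : ℕ) = countAbove (Body q.reverse z.reverse) k t then coeffMat P t else 0 := by
      intro i j
      ext α β
      change (M (i, α) (j, β)).coeff 1 = _
      rw [hM, hent]
      rw [h.negProd_apply_of_body _ _ _ _ _ (hrow i).1 (hcol j).1, ← (hrow i).2, ← (hcol j).2,
        Matrix.sum_apply]
      simp only [coeff_sub, coeff_X_mul, coeff_C_zero, coeff_C_succ, sub_zero]
      refine Finset.sum_congr rfl fun t _ => ?_
      split_ifs <;> rfl
    have h0 : ∀ i j, blk (coeffMat M 0) i j = ∑ t ∈ q.toFinset,
        if (i : ℕ) = countAbove (Body q z) k t - 1 ∧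
          (j : ℕ) = countAbove (Body q.reverse z.reverse) k t - 1 then coeffMat P t else 0 := by
      intro i j
      ext α β
      change (M (i, α) (j, β)).coeff 0 = _
      rw [hM, hent]
      rw [h.posProd_apply_of_body _ _ _ _ _ (hrow i).1 (hcol j).1, ← (hrow i).2, ← (hcol j).2,
        Matrix.sum_apply]
      simp only [coeff_sub, mul_coeff_zero, coeff_X_zero, zero_mul, coeff_C_zero, zero_sub,
        ← Finset.sum_neg_distrib]
      refine Finset.sum_congr rfl fun t ht => ?_
      have ht : t ∈ q := List.mem_toFinset.1 ht
      have h2 := h.countAbove_body_pos ht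
      have h3 := h.reverse.countAbove_body_pos (List.mem_reverse.2 ht)
      -- Counts at wires of `q` are positive, so the truncated subtraction loses nothing.
      have e : ∀ x y : ℕ, 1 ≤ y → (x + 1 = y ↔ x = y - 1) := by omega
      rw [if_congr (and_congr (e i _ h2.1) (e j _ h3.1)) rfl rfl]
      split_ifs <;> simp
    rw [antidiagSum]
    simp only [h1, h0]
    rw [show a + b + 1 = k by omega]
    exact h.sum_antidiagonal_eq ha' hb' (coeffMat P) (by omega)

end IsProperTuples

end Fiedler

namespace Fiedler

/-! ### Reduction to proper pencils -/

section List

variable {G : Type*} [Monoid G] {f : ℕ → G} {a c : ℕ} {l : List ℕ}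

/-- Only the factor of `c` may fail to commute with that of `a`. As it does not stand to the right
of `a`, the factor of `a` slides to the right end. -/
theorem prod_map_eq_erase_mul (hl : l.Nodup) (ha : a ∈ l)
    (hf : ∀ b ∈ l, b ≠ a → b ≠ c → Commute (f a) (f b)) (h : ¬ LeftOf a c l) :
    (l.map f).prod = ((l.erase a).map f).prod * f a := by
  induction l with
  | nil => simp at ha
  | cons x l ih =>
    have hl' := List.nodup_cons.1 hl
    rw [leftOf_cons hl, not_or] at h
    by_cases hx : x = a
    · subst hx
      rw [List.erase_cons_head, List.map_cons, List.prod_cons]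
      refine Commute.list_prod_right _ _ fun y hy => ?_
      obtain ⟨b, hb, rfl⟩ := List.mem_map.1 hy
      exact hf b (by simp [hb]) (fun h' => hl'.1 (h' ▸ hb)) fun h' => h.2 ⟨rfl, h' ▸ hb⟩
    · have ha' : a ∈ l := (List.mem_cons.1 ha).resolve_left (Ne.symm hx)
      rw [List.erase_cons_tail (by simpa using hx), List.map_cons, List.prod_cons, List.map_cons,
        List.prod_cons, ih hl'.2 ha' (fun b hb => hf b (by simp [hb])) h.1, mul_assoc]

theorem prod_map_eq_mul_erase (hl : l.Nodup) (ha : a ∈ l)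
    (hf : ∀ b ∈ l, b ≠ a → b ≠ c → Commute (f a) (f b)) (h : ¬ LeftOf c a l) :
    (l.map f).prod = f a * ((l.erase a).map f).prod := by
  induction l with
  | nil => simp at ha
  | cons x l ih =>
    have hl' := List.nodup_cons.1 hl
    rw [leftOf_cons hl, not_or] at h
    by_cases hx : x = a
    · subst hx
      rw [List.erase_cons_head, List.map_cons, List.prod_cons]
    · have ha' : a ∈ l := (List.mem_cons.1 ha).resolve_left (Ne.symm hx)
      have hc : x ≠ c := fun h' => h.2 ⟨h'.symm, ha'⟩
      rw [List.erase_cons_tail (by simpa using hx), List.map_cons, List.prod_cons, List.map_cons,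
        List.prod_cons, ih hl'.2 ha' (fun b hb => hf b (by simp [hb])) h.1, ← mul_assoc,
        ← mul_assoc, (hf x (by simp) hx hc).eq]

theorem leftOf_append_singleton {b x : ℕ} (ha : a ≠ x) (hb : b ≠ x) :
    LeftOf a b (l ++ [x]) ↔ LeftOf a b l := by
  unfold LeftOf
  simp only [List.mem_append, List.mem_singleton, ha, hb, or_false]
  refine and_congr_right fun h1 => and_congr_right fun h2 => ?_
  rw [List.idxOf_append_of_mem h1, List.idxOf_append_of_mem h2]

end List

theorem isGFPTuples_iff {k : ℕ} {q z : List ℕ} : IsGFPTuples k q z ↔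
    q.Nodup ∧ z.Nodup ∧ (∀ i ∈ q, i ∉ z) ∧ ∀ i, i ∈ q ∨ i ∈ z ↔ i ≤ k := by
  unfold IsGFPTuples
  simp only [Finset.disjoint_left, List.mem_toFinset, Finset.ext_iff, Finset.mem_union,
    Finset.mem_range, Nat.lt_succ_iff]

theorem IsGFPTuples.symm {k : ℕ} {q z : List ℕ} (h : IsGFPTuples k q z) : IsGFPTuples k z q := by
  obtain ⟨h1, h2, h3, h4⟩ := h
  exact ⟨h2, h1, h3.symm, by rwa [Finset.union_comm]⟩

theorem IsGFPTuples.move {k a : ℕ} {q z q' : List ℕ} (h : IsGFPTuples k q z) (ha : a ∈ z)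
    (hq' : q'.Perm (a :: q)) : IsGFPTuples k q' (z.erase a) := by
  rw [isGFPTuples_iff] at h ⊢
  obtain ⟨h1, h2, h3, h4⟩ := h
  refine ⟨?_, h2.erase a, fun i hi => ?_, fun i => ?_⟩
  · rw [hq'.nodup_iff, List.nodup_cons]
    exact ⟨fun h' => h3 a h' ha, h1⟩
  · rw [h2.mem_erase_iff]
    rintro ⟨h5, h6⟩
    rcases List.mem_cons.1 (hq'.mem_iff.1 hi) with h7 | h7
    · exact h5 h7
    · exact h3 i h7 h6
  · rw [h2.mem_erase_iff, hq'.mem_iff, List.mem_cons, ← h4 i]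
    by_cases hi : i = a
    · simp [hi, ha]
    · simp [hi]

variable {F : Type*} [Field F] {k n : ℕ}

/-! ### Block-diagonal matrices acting on one wire -/

theorem unitCol_transpose_mul_self {w : ℕ} (h1 : 1 ≤ w) (h2 : w ≤ k) :
    (unitCol F k n w)ᵀ * unitCol F k n w = 1 := by
  obtain ⟨s, hs⟩ := exists_wire h1 h2
  ext a b
  rw [mul_unitCol_apply _ s hs]
  simp [unitCol, hs, Matrix.one_apply, eq_comm]

/-- The identity matrix with the diagonal block on wire `w` replaced by `B`. -/
def wireDiag (k w : ℕ) (B : Matrix (Fin n) (Fin n) F) :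
    Matrix (Fin k × Fin n) (Fin k × Fin n) F :=
  1 + unitCol F k n w * (B - 1) * (unitCol F k n w)ᵀ

theorem wireDiag_apply {w : ℕ} (B : Matrix (Fin n) (Fin n) F) (x y : Fin k × Fin n) :
    wireDiag k w B x y =
      if x.1 = y.1 then (if (x.1 : ℕ) + w = k then B x.2 y.2
        else (1 : Matrix (Fin n) (Fin n) F) x.2 y.2) else 0 := by
  rw [wireDiag, Matrix.add_apply, unitCol_mul_mul_unitCol_apply]
  obtain ⟨r, α⟩ := x
  obtain ⟨s, β⟩ := y
  simp only [Matrix.one_apply, Matrix.sub_apply, Prod.mk.injEq]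
  by_cases hrs : r = s
  · subst hrs
    by_cases hw : (r : ℕ) + w = k <;> simp [hw]
  · have : ¬ ((r : ℕ) + w = k ∧ (s : ℕ) + w = k) := fun h => hrs (Fin.ext (by omega))
    simp [hrs, this]

@[simp]
theorem wireDiag_one (w : ℕ) : wireDiag k w (1 : Matrix (Fin n) (Fin n) F) = 1 := by
  simp [wireDiag]

theorem wireDiag_mul {w : ℕ} (h1 : 1 ≤ w) (h2 : w ≤ k) (B C : Matrix (Fin n) (Fin n) F) :
    wireDiag k w B * wireDiag k w C = wireDiag k w (B * C) := by
  have h := unitCol_transpose_mul_self (F := F) (n := n) h1 h2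
  have : unitCol F k n w * (B - 1) * (unitCol F k n w)ᵀ *
      (unitCol F k n w * (C - 1) * (unitCol F k n w)ᵀ) =
      unitCol F k n w * ((B - 1) * (C - 1)) * (unitCol F k n w)ᵀ := by
    calc _ = unitCol F k n w * (B - 1) * ((unitCol F k n w)ᵀ *
          unitCol F k n w) * (C - 1) * (unitCol F k n w)ᵀ := by simp only [Matrix.mul_assoc]
      _ = _ := by rw [h, Matrix.mul_one, Matrix.mul_assoc _ (B - 1)]
  simp only [wireDiag]
  rw [Matrix.add_mul, Matrix.mul_add, Matrix.mul_add, this, Matrix.one_mul, Matrix.one_mul,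
    Matrix.mul_one, add_assoc, ← Matrix.add_mul, ← Matrix.add_mul, ← Matrix.mul_add,
    ← Matrix.mul_add]
  congr 4
  noncomm_ring

theorem wireDiag_inv {w : ℕ} (h1 : 1 ≤ w) (h2 : w ≤ k) {B : Matrix (Fin n) (Fin n) F}
    (hB : IsUnit B) : (wireDiag k w B)⁻¹ = wireDiag k w B⁻¹ := by
  refine Matrix.inv_eq_right_inv ?_
  rw [wireDiag_mul h1 h2, Matrix.mul_nonsing_inv _ ((Matrix.isUnit_iff_isUnit_det _).1 hB),
    wireDiag_one]

theorem elemPosCore_zero_eq (B : Matrix (Fin n) (Fin n) F) :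
    elemPosCore k 0 B = wireDiag k 1 B := by
  ext x y
  rw [wireDiag_apply]
  have hx := x.1.2
  have hy := y.1.2
  simp only [elemPosCore, ofBlocks, add_zero, Fin.ext_iff]
  split_ifs <;> first | rfl | omega

theorem elemNegCore_self_eq (B : Matrix (Fin n) (Fin n) F) :
    elemNegCore k k B = wireDiag k k B := by
  ext x y
  rw [wireDiag_apply]
  simp only [elemNegCore, ofBlocks, Fin.ext_iff]
  split_ifs <;> first | rfl | omega

theorem commute_wireDiag {w : ℕ} {E : Matrix (Fin k × Fin n) (Fin k × Fin n) F}
    (h1 : E * unitCol F k n w = unitCol F k n w)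
    (h2 : Eᵀ * unitCol F k n w = unitCol F k n w) (B : Matrix (Fin n) (Fin n) F) :
    Commute (wireDiag k w B) E := by
  have h3 : (unitCol F k n w)ᵀ * E = (unitCol F k n w)ᵀ := by
    rw [← Matrix.transpose_transpose E, ← Matrix.transpose_mul, h2]
  rw [Commute, SemiconjBy, wireDiag, Matrix.add_mul, Matrix.mul_add, Matrix.one_mul,
    Matrix.mul_one, Matrix.mul_assoc _ _ E, h3, ← Matrix.mul_assoc, ← Matrix.mul_assoc, h1]

theorem elemNegCore_mul_unitCol_of_ne {i w : ℕ} (B : Matrix (Fin n) (Fin n) F) (hik : i ≤ k)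
    (h1 : w ≠ i) (h2 : w ≠ i + 1) (hw : w ≤ k) :
    elemNegCore k i B * unitCol F k n w = unitCol F k n w := by
  have := unitCol_submatrix (F := F) (k := k) (n := n) (w := k + 1 - w) (by omega)
  rw [Nat.sub_sub_self (by omega)] at this
  rw [elemNegCore_eq_submatrix hik, ← this,
    Matrix.submatrix_mul_equiv _ _ (revEquiv k n) (revEquiv k n) id,
    elemPosCore_mul_unitCol_of_ne _ (by omega) (by omega)]

theorem commute_wireDiag_elemPosCore {i w : ℕ} (h1 : w ≠ i) (h2 : w ≠ i + 1)
    (B C : Matrix (Fin n) (Fin n) F) : Commute (wireDiag k w B) (elemPosCore k i C) :=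
  commute_wireDiag (elemPosCore_mul_unitCol_of_ne _ h1 h2)
    (by rw [elemPosCore_transpose, elemPosCore_mul_unitCol_of_ne _ h1 h2]) B

theorem commute_wireDiag_elemNegCore {i w : ℕ} (hik : i ≤ k) (h1 : w ≠ i) (h2 : w ≠ i + 1)
    (hw : w ≤ k) (B C : Matrix (Fin n) (Fin n) F) :
    Commute (wireDiag k w B) (elemNegCore k i C) :=
  commute_wireDiag (elemNegCore_mul_unitCol_of_ne _ hik h1 h2 hw)
    (by rw [elemNegCore_transpose hik, elemNegCore_mul_unitCol_of_ne _ hik h1 h2 hw]) B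

theorem cornerDiag_eq (hk : 2 ≤ k) (D₁ D₂ : Matrix (Fin n) (Fin n) F) :
    cornerDiag k D₁ D₂ = wireDiag k k D₁ * wireDiag k 1 D₂ := by
  have h : wireDiag k k D₁ * (unitCol F k n 1) = unitCol F k n 1 := by
    rw [← elemNegCore_self_eq, elemNegCore_mul_unitCol_of_ne _ le_rfl] <;> omega
  rw [wireDiag.eq_1 k 1, Matrix.mul_add, Matrix.mul_one, ← Matrix.mul_assoc, ← Matrix.mul_assoc, h]
  ext x y
  rw [Matrix.add_apply, wireDiag_apply, unitCol_mul_mul_unitCol_apply]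
  simp only [cornerDiag, ofBlocks, Fin.ext_iff]
  by_cases h1 : (x.1 : ℕ) = y.1
  · by_cases h2 : (x.1 : ℕ) = 0
    · have h3 : (y.1 : ℕ) = 0 := by omega
      have h4 : 1 ≠ k := by omega
      simp [h2, h3, h4]
    · by_cases h3 : (x.1 : ℕ) + 1 = k
      · have h4 : (y.1 : ℕ) + 1 = k := by omega
        have h5 : (y.1 : ℕ) ≠ 0 := by omega
        simp [h1, h4, h5]
      · have h4 : (y.1 : ℕ) + 1 ≠ k := by omega
        have h5 : (y.1 : ℕ) ≠ 0 := by omega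
        simp [h1, h4, h5]
  · have : ¬ ((x.1 : ℕ) + 1 = k ∧ (y.1 : ℕ) + 1 = k) := by omega
    simp [h1, this]

/-- The corner -A_0 sits on a side to which `M_{-0}` can be slid past everything but `M_{-1}`. The
clauses on nonzero entries guarantee that `L₁` and `R₁` are unchanged by the move. -/
theorem exists_tuples_zero_mem (hk : 2 ≤ k) {P : Matrix (Fin n) (Fin n) F[X]} {q z : List ℕ}
    (h : IsGFPTuples k q z) (hA : 0 ∈ z → IsUnit (coeffMat P 0)) :
    ∃ q' z', IsGFPTuples k q' z' ∧ 0 ∈ q' ∧ (∀ a, a ≠ 0 → (a ∈ q' ↔ a ∈ q)) ∧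
      (∀ a b, a ≠ 0 → b ≠ 0 → (LeftOf a b q' ↔ LeftOf a b q)) ∧
      wireDiag k 1 (L₂ P z) * prodPos k P q * wireDiag k 1 (R₂ P z) = prodPos k P q' ∧
      wireDiag k 1 (L₂ P z) * prodNeg k P z * wireDiag k 1 (R₂ P z) = prodNeg k P z' := by
  have hi := isGFPTuples_iff.1 h
  by_cases hz : 0 ∈ z
  · have hq : 0 ∉ q := fun h' => hi.2.2.1 0 h' hz
    have hAu : IsUnit (-coeffMat P 0) := (hA hz).neg
    have hdet := (Matrix.isUnit_iff_isUnit_det _).1 hAu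
    have hf0 : elemNegP k P 0 = wireDiag k 1 (-coeffMat P 0)⁻¹ := by
      rw [elemNegP, if_pos rfl, elemNeg, if_pos rfl, elemPosCore_zero_eq,
        wireDiag_inv (by omega) (by omega) hAu]
    have hg0 : elemPosP k P 0 = wireDiag k 1 (-coeffMat P 0) := by
      rw [elemPosP, if_neg (by omega), elemPos, if_neg (by omega), elemPosCore_zero_eq]
    have hcomm : ∀ b ∈ z, b ≠ 0 → b ≠ 1 → Commute (elemNegP k P 0) (elemNegP k P b) := by
      intro b hb h0 h1
      rw [hf0, elemNegP, if_neg h0, elemNeg, if_neg h0]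
      exact commute_wireDiag_elemNegCore ((hi.2.2.2 b).1 (Or.inr hb)) (by omega) (by omega)
        (by omega) _ _
    by_cases hl : LeftOf 0 1 z
    · have hL : L₂ P z = -coeffMat P 0 := if_pos hl
      have hR : R₂ P z = 1 := by
        rw [R₂, if_neg hl.asymm, if_neg fun h' => h'.2 hl.2.1]
      refine ⟨0 :: q, z.erase 0, h.move hz (List.Perm.refl _), by simp, fun a ha => by simp [ha],
        fun a b ha hb => ?_, ?_, ?_⟩
      · rw [leftOf_cons (List.nodup_cons.2 ⟨hq, hi.1⟩)]
        simp [ha]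
      · rw [hL, hR, wireDiag_one, Matrix.mul_one, prodPos, prodPos, List.map_cons, List.prod_cons,
          hg0]
      · rw [hL, hR, wireDiag_one, Matrix.mul_one, prodNeg, prodNeg,
          prod_map_eq_mul_erase hi.2.1 hz hcomm hl.asymm, hf0, ← Matrix.mul_assoc,
          wireDiag_mul (by omega) (by omega), Matrix.mul_nonsing_inv _ hdet, wireDiag_one,
          Matrix.one_mul]
    -- Here -0 is to the right of -1 or -1 is absent; in both cases `M_{-0}` slides right.
    · have hL : L₂ P z = 1 := if_neg hl
      have hR : R₂ P z = -coeffMat P 0 := by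
        rw [R₂]
        split_ifs with h1 h2
        · rfl
        · rfl
        · exact absurd ⟨hz, fun h3 => (leftOf_or hz h3 (by omega)).elim hl h1⟩ h2
      refine ⟨q ++ [0], z.erase 0, h.move hz (List.perm_append_singleton _ _), by simp,
        fun a ha => by simp [ha], fun a b ha hb => leftOf_append_singleton ha hb, ?_, ?_⟩
      · rw [hL, hR, wireDiag_one, Matrix.one_mul, prodPos, prodPos, List.map_append,
          List.prod_append, List.map_singleton, List.prod_singleton, hg0]
      · rw [hL, hR, wireDiag_one, Matrix.one_mul, prodNeg, prodNeg,
          prod_map_eq_erase_mul hi.2.1 hz hcomm hl, hf0, Matrix.mul_assoc,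
          wireDiag_mul (by omega) (by omega), Matrix.nonsing_inv_mul _ hdet, wireDiag_one,
          Matrix.mul_one]
  · have hL : L₂ P z = 1 := if_neg fun h' => hz h'.1
    have hR : R₂ P z = 1 := by
      rw [R₂, if_neg fun h' => hz h'.2.1, if_neg fun h' => hz h'.1]
    exact ⟨q, z, h, ((hi.2.2.2 0).2 (Nat.zero_le k)).resolve_right hz, by simp, by simp,
      by simp [hL, hR], by simp [hL, hR]⟩

theorem exists_tuples_top_mem (hk : 2 ≤ k) {P : Matrix (Fin n) (Fin n) F[X]} {q z : List ℕ}
    (h : IsGFPTuples k q z) (h0 : 0 ∈ q) (hA : k ∈ q → IsUnit (coeffMat P k)) :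
    ∃ q' z', IsGFPTuples k q' z' ∧ 0 ∈ q' ∧ k ∈ z' ∧
      wireDiag k k (L₁ k P q) * prodPos k P q * wireDiag k k (R₁ k P q) = prodPos k P q' ∧
      wireDiag k k (L₁ k P q) * prodNeg k P z * wireDiag k k (R₁ k P q) = prodNeg k P z' := by
  have hi := isGFPTuples_iff.1 h
  by_cases hq : k ∈ q
  · have hz : k ∉ z := hi.2.2.1 k hq
    have hdet := (Matrix.isUnit_iff_isUnit_det _).1 (hA hq)
    have hf : elemPosP k P k = wireDiag k k (coeffMat P k)⁻¹ := by
      rw [elemPosP, if_pos rfl, elemPos, if_pos rfl, elemNegCore_self_eq,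
        wireDiag_inv (by omega) le_rfl (hA hq)]
    have hg : elemNegP k P k = wireDiag k k (coeffMat P k) := by
      rw [elemNegP, if_neg (by omega), elemNeg, if_neg (by omega), elemNegCore_self_eq]
    have hcomm : ∀ b ∈ q, b ≠ k → b ≠ k - 1 → Commute (elemPosP k P k) (elemPosP k P b) := by
      intro b hb h0 h1
      rw [hf, elemPosP, if_neg h0, elemPos, if_neg h0]
      exact commute_wireDiag_elemPosCore (by omega) (by omega) _ _
    have h0' : 0 ∈ q.erase k := (hi.1.mem_erase_iff).2 ⟨by omega, h0⟩
    by_cases hl : LeftOf k (k - 1) q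
    · have hL : L₁ k P q = coeffMat P k := if_pos hl
      have hR : R₁ k P q = 1 := by
        rw [R₁, if_neg hl.asymm, if_neg fun h' => h'.2 hl.2.1]
      refine ⟨q.erase k, k :: z, (h.symm.move hq (List.Perm.refl _)).symm, h0', by simp, ?_, ?_⟩
      · rw [hL, hR, wireDiag_one, Matrix.mul_one, prodPos, prodPos,
          prod_map_eq_mul_erase hi.1 hq hcomm hl.asymm, hf, ← Matrix.mul_assoc,
          wireDiag_mul (by omega) le_rfl, Matrix.mul_nonsing_inv _ hdet, wireDiag_one,
          Matrix.one_mul]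
      · rw [hL, hR, wireDiag_one, Matrix.mul_one, prodNeg, prodNeg, List.map_cons, List.prod_cons,
          hg]
    · have hL : L₁ k P q = 1 := if_neg hl
      have hR : R₁ k P q = coeffMat P k := by
        rw [R₁]
        split_ifs with h1 h2
        · rfl
        · rfl
        · exact absurd ⟨hq, fun h3 => (leftOf_or hq h3 (by omega)).elim hl h1⟩ h2
      refine ⟨q.erase k, z ++ [k], (h.symm.move hq (List.perm_append_singleton _ _)).symm, h0',
        by simp, ?_, ?_⟩
      · rw [hL, hR, wireDiag_one, Matrix.one_mul, prodPos, prodPos,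
          prod_map_eq_erase_mul hi.1 hq hcomm hl, hf, Matrix.mul_assoc,
          wireDiag_mul (by omega) le_rfl, Matrix.nonsing_inv_mul _ hdet, wireDiag_one,
          Matrix.mul_one]
      · rw [hL, hR, wireDiag_one, Matrix.one_mul, prodNeg, prodNeg, List.map_append,
          List.prod_append, List.map_singleton, List.prod_singleton, hg]
  · have hL : L₁ k P q = 1 := if_neg fun h' => hq h'.1
    have hR : R₁ k P q = 1 := by
      rw [R₁, if_neg fun h' => hq h'.2.1, if_neg fun h' => hq h'.1]
    exact ⟨q, z, h, h0, ((hi.2.2.2 k).2 le_rfl).resolve_left hq, by simp [hL, hR],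
      by simp [hL, hR]⟩

/-! ### The proper pencil obtained after the moves -/

theorem IsGFPTuples.isProperTuples {q z : List ℕ} (h : IsGFPTuples k q z) (h0 : 0 ∈ q)
    (hk : k ∈ z) : IsProperTuples k q z := by
  obtain ⟨h1, h2, h3, h4⟩ := isGFPTuples_iff.1 h
  exact ⟨h1, h2, h3, fun i hi => (h4 i).2 hi, fun i hi => (h4 i).1 (Or.inl hi),
    fun i hi => (h4 i).1 (Or.inr hi), h0, hk⟩

theorem IsProperTuples.prodPos_eq {P : Matrix (Fin n) (Fin n) F[X]} {q z : List ℕ}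
    (h : IsProperTuples k q z) : prodPos k P q = posProd k (fun i => -coeffMat P i) q := by
  unfold prodPos posProd
  congr 1
  refine List.map_congr_left fun i hi => ?_
  have : i ≠ k := fun h' => h.disjoint i hi (h' ▸ h.top_mem)
  rw [elemPosP, if_neg this, elemPos, if_neg this]

theorem IsProperTuples.prodNeg_eq {P : Matrix (Fin n) (Fin n) F[X]} {q z : List ℕ}
    (h : IsProperTuples k q z) : prodNeg k P z = negProd k (coeffMat P) z := by
  unfold prodNeg negProd
  congr 1
  refine List.map_congr_left fun i hi => ?_
  have : i ≠ 0 := fun h' => h.disjoint 0 h.zero_mem (h' ▸ hi)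
  rw [elemNegP, if_neg this, elemNeg, if_neg this]

theorem constMat_mul {l m r : Type*} [Fintype m] (A : Matrix l m F) (B : Matrix m r F) :
    constMat (A * B) = constMat A * constMat B :=
  Matrix.map_mul (f := Polynomial.C)

theorem constMat_mul_gfp_mul_constMat (P : Matrix (Fin n) (Fin n) F[X]) (q z : List ℕ)
    (L R : Matrix (Fin k × Fin n) (Fin k × Fin n) F) :
    constMat L * gfp k P q z * constMat R = (X : F[X]) • constMat (L * prodNeg k P z * R) -
      constMat (L * prodPos k P q * R) := by
  simp only [gfp, constMat_mul, Matrix.mul_sub, Matrix.sub_mul, Matrix.mul_smul, Matrix.smul_mul]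

end Fiedler

theorem theorem7p4 {F : Type*} [Field F] (n k : ℕ) (hk : 2 ≤ k)
    (P : Matrix (Fin n) (Fin n) F[X]) (hP : Fiedler.HasGrade k P)
    (q z : List ℕ) (hqz : Fiedler.IsGFPTuples k q z)
    (hA0 : 0 ∈ z → IsUnit (Fiedler.coeffMat P 0))
    (hAk : k ∈ q → IsUnit (Fiedler.coeffMat P k))
    (hnonproper : ¬ Fiedler.IsProper k q z) :
    ∃ (l r : Equiv.Perm (Fin k)) (a b : ℕ)
      (M : Matrix (Fin (b + 1) × Fin n) (Fin (a + 1) × Fin n) F[X]),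
      Fiedler.IsBlockKroneckerPencil a b
        (Fiedler.blockTranspose (Fiedler.blockPerm n l) *
          (Fiedler.constMat (Fiedler.leftFactor k P q z) * Fiedler.gfp k P q z *
            Fiedler.constMat (Fiedler.rightFactor k P q z)) *
          Fiedler.blockPerm n r) M ∧
      Fiedler.ASCondition M P := by
  open Fiedler in
  obtain ⟨q₁, z₁, h₁, h0, hmem, hleft, hQ₁, hZ₁⟩ := exists_tuples_zero_mem hk hqz hA0
  obtain ⟨q₂, z₂, h₂, h0', hk', hQ₂, hZ₂⟩ := exists_tuples_top_mem hk h₁ h0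
    fun h => hAk ((hmem k (by omega)).1 h)
  -- These factors depend only on `k` and `k - 1`, which are nonzero as `2 ≤ k`.
  have hL : L₁ k P q₁ = L₁ k P q := by
    rw [L₁, L₁, propext (hleft k (k - 1) (by omega) (by omega))]
  have hR : R₁ k P q₁ = R₁ k P q := by
    rw [R₁, R₁, propext (hleft (k - 1) k (by omega) (by omega))]
    simp only [hmem k (by omega), hmem (k - 1) (by omega)]
  have hp := h₂.isProperTuples h0' hk'
  -- The corners of `R` act on the distinct wires `k` and 1; exchanging them nests the move of 0
  -- inside the move of `k`.
  have hcomm : Commute (wireDiag k k (R₁ k P q)) (wireDiag k 1 (R₂ P z)) := by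
    rw [← elemPosCore_zero_eq]
    exact commute_wireDiag_elemPosCore (by omega) (by omega) _ _
  have key : ∀ K : Matrix (Fin k × Fin n) (Fin k × Fin n) F,
      leftFactor k P q z * K * rightFactor k P q z = wireDiag k k (L₁ k P q₁) *
        (wireDiag k 1 (L₂ P z) * K * wireDiag k 1 (R₂ P z)) * wireDiag k k (R₁ k P q₁) := by
    intro K
    rw [leftFactor, rightFactor, cornerDiag_eq hk, cornerDiag_eq hk, hcomm.eq, hL, hR]
    simp only [Matrix.mul_assoc]
  refine hp.exists_blockKronecker P _ ?_
  rw [constMat_mul_gfp_mul_constMat, key, key, hQ₁, hZ₁, hQ₂, hZ₂, hp.prodPos_eq, hp.prodNeg_eq]
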